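/- A tournamenton is a measurable function $W:[0,1]^2\to[0,\infty)$ with $W(x,y)+W(y,x)=1$ for all $x,y\in[0,1]$. For a finite oriented graph $H$ with vertex set $V(H)$, arc set $E(H)$ and $\|H\|=|E(H)|$, let $$t(H,W)=\int_{[0,1]^{V(H)}}\prod_{vw\in E(H)}W(x_v,x_w)\,\mathrm{d}x_{V(H)}.$$ The oriented graph $H$ is quasirandom-forcing if every tournamenton $W$ with $t(H,W)=2^{-\|H\|}$ is equal to $1/2$ almost everywhere. Call two oriented graphs similar if one of them is isomorphic to the other or to the converse of the other (the graph obtained by reversing all arcs). For positive integers $a_1,\dots,a_m$ with sum $\ell$, where $m=1$ or $m$ is even, let $C(a_1,\dots,a_m)$ be the orientation of the cycle of length $\ell$ in which, following the cycle in a fixed direction, the first $a_1$ edges are directed forward, the next $a_2$ edges backward, the next $a_3$ edges forward, and so on. Write $1^k$ for $k$ consecutive entries equal to $1$. **Theorem.** For $\ell\in\{4,6,8,10\}$, an orientation of the cycle of length $\ell$ is quasirandom-forcing if and only if it is similar to one of the following orientations: - $\ell=4$: $C(3,1)$, $C(2,2)$, $C(1^4)$; - $\ell=6$: $C(6)$,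 $C(4,2)$, $C(2,2,1,1)$, $C(1^6)$; - $\ell=8$: $C(7,1)$, $C(5,3)$, $C(4,2,1,1)$, $C(3,2,2,1)$, $C(3,2,1,2)$, $C(2,2,2,2)$, $C(2,2,1^4)$, $C(2,1,1,2,1,1)$, $C(1^8)$; - $\ell=10$: $C(10)$, $C(8,2)$, $C(6,4)$, $C(7,1^3)$, $C(6,1,2,1)$, $C(5,1,3,1)$, $C(5,3,1,1)$, $C(5,2,1,2)$, $C(4,1,4,1)$, $C(4,3,2,1)$, $C(4,2,2,2)$, $C(3,3,3,1)$, $C(3,2,3,2)$, $C(3,3,1^4)$, $C(3,2,1,2,1,1)$, $C(3,2,1,1,1,2)$, $C(2,2,2,2,1,1)$, $C(2,2,1,2,2,1)$, $C(2,2,1^6)$, $C(2,1,1,2,1^4)$, $C(1^{10})$; and it is not quasirandom-forcing if and only if it is similar to one of the following orientations: - $\ell=4$: $C(4)$; - $\ell=6$: $C(5,1)$, $C(3,3)$, $C(3,1^3)$, $C(2,1,2,1)$; - $\ell=8$: $C(8)$, $C(6,2)$, $C(4,4)$, $C(5,1^3)$, $C(4,1,2,1)$, $C(3,1,3,1)$,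 $C(3,3,1,1)$, $C(3,1^5)$, $C(2,1,2,1^3)$; - $\ell=10$: $C(9,1)$, $C(7,3)$, $C(5,5)$, $C(6,2,1,1)$, $C(5,2,2,1)$, $C(4,2,3,1)$, $C(4,4,1,1)$, $C(4,3,1,2)$, $C(3,3,2,2)$, $C(5,1^5)$, $C(4,1,2,1^3)$, $C(4,2,1^4)$, $C(4,1,1,2,1,1)$, $C(3,1,3,1^3)$, $C(3,1,2,1,2,1)$, $C(3,2,1,1,2,1)$, $C(3,1,2,2,1,1)$, $C(3,2,2,1^3)$, $C(3,1,1,3,1,1)$, $C(2,2,2,1,2,1)$, $C(3,1^7)$, $C(2,1,2,1^5)$, $C(2,1^3,2,1^3)$. Up to similarity, the cycles of length $4,6,8,10$ have exactly $4,8,18,44$ orientations, of which exactly $3,4,9,21$, respectively, are quasirandom-forcing. If $p_\ell$ denotes the probability that the orientation of the cycle of length $\ell$ obtained by directing each edge independently and uniformly at random is quasirandom-forcing, then $p_4=7/8$, $p_6=7/16$, $p_8=71/128$ and $p_{10}=207/512$. -/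

import Mathlib

open MeasureTheory
open scoped unitInterval

namespace QuasirandomCycles

/-! ### Tournament limits and homomorphism densities -/

/-- A tournamenton: a measurable non-negative function `W` on `[0,1]²` such that
`W(x,y) + W(y,x) = 1` for all `x, y` (boundedness follows). -/
structure Tournamenton where
  toFun : I → I → ℝ
  measurable_toFun : Measurable (Function.uncurry toFun)
  nonneg : ∀ x y, 0 ≤ toFun x y
  add_swap : ∀ x y, toFun x y + toFun y x = 1

/-- The set of arcs `(v, w)` of a directed graph on a finite vertex set. -/
noncomputable def arcs {V : Type*} [Fintype V] (H : Digraph V) : Finset (V × V) :=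
  Set.Finite.toFinset (Set.toFinite {e : V × V | H.Adj e.1 e.2})

/-- The homomorphism density `t(H, U) = ∫_{[0,1]^V} ∏_{vw ∈ E(H)} U(x_v, x_w) dx`. -/
noncomputable def homDensity {V : Type*} [Fintype V] (H : Digraph V) (U : I → I → ℝ) : ℝ :=
  ∫ x : V → I, ∏ e ∈ arcs H, U (x e.1) (x e.2)

/-- `H` is quasirandom-forcing if the only tournamenton `W` (up to a null set) with
`t(H, W) = 2^{-‖H‖}`, where `‖H‖` is the number of arcs of `H`, is the constant `1/2`. -/
def IsQuasirandomForcing {V : Type*} [Fintype V] (H : Digraph V) : Prop :=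
  ∀ W : Tournamenton, homDensity H W.toFun = (1 / 2 : ℝ) ^ (arcs H).card →
    ∀ᵐ p : I × I, W.toFun p.1 p.2 = 1 / 2

/-! ### Orientations of cycles -/

/-- `H` is an orientation of the simple graph `G`: each edge of `G` is directed in exactly one
of the two possible ways, and `H` has no other arcs. -/
def IsOrientation {V : Type*} (G : SimpleGraph V) (H : Digraph V) : Prop :=
  (∀ v w, H.Adj v w → ¬ H.Adj w v) ∧ ∀ v w, G.Adj v w ↔ (H.Adj v w ∨ H.Adj w v)

/-- The orientations of the cycle of length `ℓ` on the vertex set `Fin ℓ`. -/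
abbrev CycleOrientation (ℓ : ℕ) : Type :=
  {H : Digraph (Fin ℓ) // IsOrientation (SimpleGraph.cycleGraph ℓ) H}

/-- `H` is isomorphic to `K` or to the converse of `K` (all arcs of `K` reversed). -/
def Similar {V W : Type*} (H : Digraph V) (K : Digraph W) : Prop :=
  Nonempty (H.Adj ≃r K.Adj) ∨ Nonempty (H.Adj ≃r fun v w => K.Adj w v)

theorem Similar.refl {V : Type*} (H : Digraph V) : Similar H H :=
  Or.inl ⟨RelIso.refl _⟩

theorem Similar.symm {V W : Type*} {H : Digraph V} {K : Digraph W} (h : Similar H K) :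
    Similar K H := by
  rcases h with ⟨⟨e⟩⟩ | ⟨⟨e⟩⟩
  · exact Or.inl ⟨e.symm⟩
  · exact Or.inr ⟨e.symm.toEquiv, fun {a b} => e.symm.map_rel_iff (a := b) (b := a)⟩

theorem Similar.trans {U V W : Type*} {H : Digraph U} {K : Digraph V} {L : Digraph W}
    (h : Similar H K) (h' : Similar K L) : Similar H L := by
  rcases h with ⟨⟨e⟩⟩ | ⟨⟨e⟩⟩ <;> rcases h' with ⟨⟨f⟩⟩ | ⟨⟨f⟩⟩
  · exact Or.inl ⟨e.trans f⟩
  · exact Or.inr ⟨e.trans f⟩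
  · exact Or.inr ⟨e.toEquiv.trans f.toEquiv,
      fun {_ _} => f.map_rel_iff.trans e.map_rel_iff⟩
  · exact Or.inl ⟨e.toEquiv.trans f.toEquiv,
      fun {_ _} => f.map_rel_iff.trans e.map_rel_iff⟩

/-- Similarity as an equivalence relation on the orientations of the cycle of length `ℓ`. -/
def cycleSetoid (ℓ : ℕ) : Setoid (CycleOrientation ℓ) where
  r C D := Similar C.1 D.1
  iseqv := ⟨fun C => Similar.refl C.1, Similar.symm, Similar.trans⟩

/-- The similarity classes of orientations of the cycle of length `ℓ`. -/
abbrev CycleClass (ℓ : ℕ) : Type := Quotient (cycleSetoid ℓ)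

/-- The similarity classes containing a quasirandom-forcing orientation. -/
def forcingClasses (ℓ : ℕ) : Set (CycleClass ℓ) :=
  (fun C => Quotient.mk (cycleSetoid ℓ) C) '' {C | IsQuasirandomForcing C.1}

/-- The oriented cycle on `Fin ℓ` whose edge between `i` and `i + 1` (modulo `ℓ`) is directed
from `i` to `i + 1` if `s i` is true, and from `i + 1` to `i` otherwise. -/
def cycleOfSigns {ℓ : ℕ} (s : Fin ℓ → Bool) : Digraph (Fin ℓ) where
  Adj v w := ((w : ℕ) = ((v : ℕ) + 1) % ℓ ∧ s v = true) ∨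
    ((v : ℕ) = ((w : ℕ) + 1) % ℓ ∧ s w = false)

/-- The probability that the orientation of the cycle of length `ℓ`, obtained by directing each
edge by an independent fair coin flip, is quasirandom-forcing. -/
noncomputable def forcingProbability (ℓ : ℕ) : ℝ :=
  (Measure.pi fun _ : Fin ℓ => (PMF.uniformOfFintype Bool).toMeasure).real
    {s | IsQuasirandomForcing (cycleOfSigns s)}

/-! ### The classification tables -/

/-- `blockSigns b [a₁, a₂, …]` consists of `a₁` signs `b`, then `a₂` signs `!b`, then
`a₃` signs `b`, and so on. -/
def blockSigns : Bool → List ℕ → List Bool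
  | _, [] => []
  | b, a :: l => List.replicate a b ++ blockSigns (!b) l

/-- The oriented cycle of length `ℓ = a₁ + ⋯ + a_m` whose edges, in the cyclic order, are
`a₁` forward edges, then `a₂` backward edges, then `a₃` forward edges, and so on. -/
def cycleOfBlocks (ℓ : ℕ) (a : List ℕ) : Digraph (Fin ℓ) :=
  cycleOfSigns fun i : Fin ℓ => (blockSigns true a).getD i true

/-- The quasirandom-forcing orientations of the cycles of length 4, 6, 8 and 10. -/
def forcingTypes : ℕ → List (List ℕ)
  | 4 => [[3, 1], [2, 2], [1, 1, 1, 1]]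
  | 6 => [[6], [4, 2], [2, 2, 1, 1], [1, 1, 1, 1, 1, 1]]
  | 8 => [[7, 1], [5, 3], [4, 2, 1, 1], [3, 2, 2, 1], [3, 2, 1, 2], [2, 2, 2, 2],
      [2, 2, 1, 1, 1, 1], [2, 1, 1, 2, 1, 1], [1, 1, 1, 1, 1, 1, 1, 1]]
  | 10 => [[10], [8, 2], [6, 4], [7, 1, 1, 1], [6, 1, 2, 1], [5, 1, 3, 1], [5, 3, 1, 1],
      [5, 2, 1, 2], [4, 1, 4, 1], [4, 3, 2, 1], [4, 2, 2, 2], [3, 3, 3, 1], [3, 2, 3, 2],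
      [3, 3, 1, 1, 1, 1], [3, 2, 1, 2, 1, 1], [3, 2, 1, 1, 1, 2], [2, 2, 2, 2, 1, 1],
      [2, 2, 1, 2, 2, 1], [2, 2, 1, 1, 1, 1, 1, 1], [2, 1, 1, 2, 1, 1, 1, 1],
      [1, 1, 1, 1, 1, 1, 1, 1, 1, 1]]
  | _ => []

/-- The orientations of the cycles of length 4, 6, 8 and 10 that are not quasirandom-forcing. -/
def nonForcingTypes : ℕ → List (List ℕ)
  | 4 => [[4]]
  | 6 => [[5, 1], [3, 3], [3, 1, 1, 1], [2, 1, 2, 1]]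
  | 8 => [[8], [6, 2], [4, 4], [5, 1, 1, 1], [4, 1, 2, 1], [3, 1, 3, 1], [3, 3, 1, 1],
      [3, 1, 1, 1, 1, 1], [2, 1, 2, 1, 1, 1]]
  | 10 => [[9, 1], [7, 3], [5, 5], [6, 2, 1, 1], [5, 2, 2, 1], [4, 2, 3, 1], [4, 4, 1, 1],
      [4, 3, 1, 2], [3, 3, 2, 2], [5, 1, 1, 1, 1, 1], [4, 1, 2, 1, 1, 1],
      [4, 2, 1, 1, 1, 1], [4, 1, 1, 2, 1, 1], [3, 1, 3, 1, 1, 1], [3, 1, 2, 1, 2, 1],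
      [3, 2, 1, 1, 2, 1], [3, 1, 2, 2, 1, 1], [3, 2, 2, 1, 1, 1], [3, 1, 1, 3, 1, 1],
      [2, 2, 2, 1, 2, 1], [3, 1, 1, 1, 1, 1, 1, 1], [2, 1, 2, 1, 1, 1, 1, 1],
      [2, 1, 1, 1, 2, 1, 1, 1]]
  | _ => []

end QuasirandomCycles

/-!
Write a tournamenton as `W = (1 + B) / 2` with a skew-symmetric kernel `B` with values in `[-1, 1]`.
Up to the factor `2^(-ℓ)`, the density of an oriented cycle with signs `s_1, …, s_ℓ` is the trace of
the product of the operators `J + s_i B`, where `J` is the all-one kernel. Cutting this trace at the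
factors `J` expresses it through the numbers `⟨1, B^k 1⟩` and `tr B^ℓ`
(`SkewKernel.integral_cycle`, `closedSum`). By skew-symmetry the former vanish for odd `k` and are
`± b_j` with `b_j = ‖B^j 1‖²` for `k = 2j`, while the latter is `± t` with `t` the squared
Hilbert–Schmidt norm of `B^(ℓ/2)`. Hence the relative density of an oriented cycle of even length is
an explicit polynomial `cyclePoly` in `b_1, b_2, …`, and linear in `t` with coefficient `± 1`
(`SkewKernel.cycleSum_eq`).

*Forcing orientations.* The numbers `b_j` satisfy `b_j² ≤ b_(j-1) b_(j+1)` with `b_0 = 1`,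
`b_(j+1) ≤ b_j / 2` (the singular values of `B` come in pairs and `‖B‖_HS ≤ 1`), and `b_1 ≤ 1/3`
(`IsNormSeq`). For each listed forcing orientation these inequalities show that the sum of the
remaining nonconstant terms of the polynomial vanishes or has the same sign as the term `± t`, so
that relative density one implies `t = 0`
(`IsNormSeq.cyclePoly_ne_one`), and then `B = 0` (`SkewKernel.ae_eq_zero_of_hsNormSq_eq_zero`).

*Non-forcing orientations.* If `B` is regular, i.e. `B 1 = 0`, then only the term `± t` is left. For
each listed non-forcing orientation, a single kernel gives a deviation from one of the opposite
sign: the step kernel of the transitive tournament with 7 vertices after the reversal of all arcs at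
its second vertex. On the segment between this kernel and the regular step kernel of the cyclic triangle
there is, by continuity, a kernel of relative density one, and it does not vanish
(`SkewKernel.not_isQuasirandomForcing`).

*Counting.* Being quasirandom-forcing is invariant under similarity, and two sign sequences are
similar if and only if they differ by a rotation, a reflection or a global change of signs
(`similar_cycleOfSigns_iff`). The orbits of the listed orientations are disjoint and cover all sign
sequences, which is a finite computation; this yields the classification and all counts.
-/

namespace QuasirandomCycles

/-! ### Bounded measurable functions -/

/-- Bounded measurable real functions. On a finite measure space they are integrable and closed
under all operations below, so that no integrability has to be checked case by case. -/
def BddMeas {α : Type*} [MeasurableSpace α] (f : α → ℝ) : Prop :=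
  Measurable f ∧ ∃ C, ∀ x, |f x| ≤ C

namespace BddMeas

variable {α β : Type*} [MeasurableSpace α] [MeasurableSpace β] {f g : α → ℝ}

theorem const (c : ℝ) : BddMeas (fun _ : α => c) := ⟨measurable_const, |c|, fun _ => le_rfl⟩

theorem add (hf : BddMeas f) (hg : BddMeas g) : BddMeas fun x => f x + g x := by
  obtain ⟨hf, C, hC⟩ := hf
  obtain ⟨hg, D, hD⟩ := hg
  exact ⟨hf.add hg, C + D, fun x => (abs_add_le _ _).trans (add_le_add (hC x) (hD x))⟩

theorem mul (hf : BddMeas f) (hg : BddMeas g) : BddMeas fun x => f x * g x := by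
  obtain ⟨hf, C, hC⟩ := hf
  obtain ⟨hg, D, hD⟩ := hg
  refine ⟨hf.mul hg, C * D, fun x => ?_⟩
  rw [abs_mul]
  exact mul_le_mul (hC x) (hD x) (abs_nonneg _) ((abs_nonneg _).trans (hC x))

theorem const_mul (c : ℝ) (hf : BddMeas f) : BddMeas fun x => c * f x := (const c).mul hf

theorem neg (hf : BddMeas f) : BddMeas fun x => -f x := by
  simpa using hf.const_mul (-1)

theorem sub (hf : BddMeas f) (hg : BddMeas g) : BddMeas fun x => f x - g x := by
  simpa [sub_eq_add_neg] using hf.add hg.neg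

theorem pow (hf : BddMeas f) (n : ℕ) : BddMeas fun x => f x ^ n := by
  induction n with
  | zero => simpa using const (1 : ℝ)
  | succ n ih => simpa [pow_succ] using ih.mul hf

theorem comp (hf : BddMeas f) {u : β → α} (hu : Measurable u) : BddMeas fun x => f (u x) :=
  ⟨hf.1.comp hu, hf.2.imp fun _ h x => h (u x)⟩

theorem prod {ι : Type*} (s : Finset ι) {F : ι → α → ℝ} (hF : ∀ i, BddMeas (F i)) :
    BddMeas fun x => ∏ i ∈ s, F i x := by
  classical
  induction s using Finset.induction_on with
  | empty => simpa using const (1 : ℝ)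
  | insert i s hi ih => simpa [Finset.prod_insert hi] using (hF i).mul ih

theorem integrable (hf : BddMeas f) {μ : Measure α} [IsFiniteMeasure μ] : Integrable f μ := by
  obtain ⟨hf, C, hC⟩ := hf
  exact Integrable.of_bound hf.aestronglyMeasurable C (.of_forall hC)

theorem integral {F : α → β → ℝ} (hF : BddMeas (Function.uncurry F)) {ν : Measure β}
    [IsFiniteMeasure ν] : BddMeas fun x => ∫ y, F x y ∂ν := by
  obtain ⟨hF, C, hC⟩ := hF
  refine ⟨(hF.stronglyMeasurable.integral_prod_right (ν := ν)).measurable,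
    C * ν.real Set.univ, fun x => ?_⟩
  have h : ∀ y, ‖F x y‖ ≤ C := fun y => hC (x, y)
  exact norm_integral_le_of_norm_le_const (.of_forall h)

/-- Bounded measurable functions satisfy Fubini's theorem. -/
theorem integral_swap {F : α → β → ℝ} (hF : BddMeas (Function.uncurry F)) {μ : Measure α}
    {ν : Measure β} [IsFiniteMeasure μ] [IsFiniteMeasure ν] :
    ∫ x, ∫ y, F x y ∂ν ∂μ = ∫ y, ∫ x, F x y ∂μ ∂ν :=
  integral_integral_swap hF.integrable

end BddMeas

/-- The Cauchy–Schwarz inequality for bounded measurable functions. -/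
theorem integral_mul_sq_le {α : Type*} [MeasurableSpace α] {μ : Measure α} [IsFiniteMeasure μ]
    {f g : α → ℝ} (hf : BddMeas f) (hg : BddMeas g) :
    (∫ x, f x * g x ∂μ) ^ 2 ≤ (∫ x, f x ^ 2 ∂μ) * ∫ x, g x ^ 2 ∂μ := by
  have key : ∀ t : ℝ, 0 ≤ (∫ x, g x ^ 2 ∂μ) * (t * t) + (2 * ∫ x, f x * g x ∂μ) * t
      + ∫ x, f x ^ 2 ∂μ := fun t => by
    have h : 0 ≤ ∫ x, (f x + t * g x) ^ 2 ∂μ := integral_nonneg fun x => sq_nonneg _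
    have e : ∫ x, (f x + t * g x) ^ 2 ∂μ = ∫ x, (t * t * g x ^ 2 + 2 * t * (f x * g x))
        + f x ^ 2 ∂μ := integral_congr_ae (.of_forall fun x => by ring)
    rw [e, integral_add (((hg.pow 2).const_mul _).add ((hf.mul hg).const_mul _)).integrable
      (hf.pow 2).integrable, integral_add ((hg.pow 2).const_mul _).integrable
      ((hf.mul hg).const_mul _).integrable, integral_const_mul, integral_const_mul] at h
    linarith
  have := discrim_le_zero key
  simp only [discrim] at this
  nlinarith

/-! ### Skew-symmetric kernels and their integral operators -/

/-- A measurable skew-symmetric kernel on `[0,1]²` with values in `[-1, 1]`. -/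
structure SkewKernel where
  toFun : I → I → ℝ
  measurable_toFun : Measurable (Function.uncurry toFun)
  abs_le_one : ∀ x y, |toFun x y| ≤ 1
  skew : ∀ x y, toFun y x = -toFun x y

instance : CoeFun SkewKernel fun _ => I → I → ℝ := ⟨SkewKernel.toFun⟩

namespace SkewKernel

variable (B : SkewKernel)

theorem bddMeas : BddMeas (Function.uncurry B) := ⟨B.measurable_toFun, 1, fun _ => B.abs_le_one _ _⟩

theorem bddMeas_comp {α : Type*} [MeasurableSpace α] {u v : α → I} (hu : Measurable u)
    (hv : Measurable v) : BddMeas fun a => B (u a) (v a) :=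
  B.bddMeas.comp (hu.prodMk hv)

/-- The integral operator of the kernel, acting on row vectors. -/
noncomputable def op (f : I → ℝ) : I → ℝ := fun y => ∫ x, f x * B x y

variable {α : Type*} [MeasurableSpace α]

theorem bddMeas_op_uncurry {F : α → I → ℝ} (hF : BddMeas (Function.uncurry F)) :
    BddMeas (Function.uncurry fun a => B.op (F a)) := by
  refine BddMeas.integral (F := fun (p : α × I) x => F p.1 x * B x p.2) ?_
  exact (hF.comp (u := fun q : (α × I) × I => (q.1.1, q.2)) (by fun_prop)).mul
    (B.bddMeas_comp (by fun_prop) (by fun_prop))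

theorem bddMeas_op {f : I → ℝ} (hf : BddMeas f) : BddMeas (B.op f) :=
  (B.bddMeas_op_uncurry (α := Unit) (F := fun _ => f) (hf.comp measurable_snd)).comp
    (u := fun y => ((), y)) (by fun_prop)

theorem bddMeas_iterate_uncurry {F : α → I → ℝ} (hF : BddMeas (Function.uncurry F)) (k : ℕ) :
    BddMeas (Function.uncurry fun a => B.op^[k] (F a)) := by
  induction k with
  | zero => exact hF
  | succ k ih => simpa only [Function.iterate_succ_apply'] using B.bddMeas_op_uncurry ih

theorem bddMeas_iterate {f : I → ℝ} (hf : BddMeas f) (k : ℕ) : BddMeas (B.op^[k] f) := by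
  induction k with
  | zero => exact hf
  | succ k ih => simpa only [Function.iterate_succ_apply'] using B.bddMeas_op ih

/-- The operator of a skew-symmetric kernel is skew-adjoint. -/
theorem integral_op_mul {f g : I → ℝ} (hf : BddMeas f) (hg : BddMeas g) :
    ∫ x, B.op f x * g x = -∫ x, f x * B.op g x := by
  have h1 : ∀ y, B.op f y * g y = ∫ x, f x * B x y * g y := fun y => by
    rw [op, integral_mul_const]
  have h2 : ∀ x, f x * B.op g x = -∫ y, f x * B x y * g y := fun x => by
    rw [op, ← integral_const_mul, ← integral_neg]
    refine integral_congr_ae (.of_forall fun y => ?_)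
    simp only [B.skew x y]
    ring
  simp only [h1, h2, integral_neg, neg_neg]
  refine (BddMeas.integral_swap (F := fun x y => f x * B x y * g y) ?_).symm
  exact ((hf.comp measurable_fst).mul B.bddMeas).mul (hg.comp measurable_snd)

theorem integral_iterate_mul {f g : I → ℝ} (hf : BddMeas f) (hg : BddMeas g) (a b : ℕ) :
    ∫ x, B.op^[a] f x * B.op^[b] g x = (-1) ^ a * ∫ x, f x * B.op^[a + b] g x := by
  induction a generalizing b with
  | zero => simp
  | succ a ih =>
    rw [Function.iterate_succ_apply', B.integral_op_mul (B.bddMeas_iterate hf a)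
      (B.bddMeas_iterate hg b), ← Function.iterate_succ_apply' B.op, ih (b + 1), pow_succ,
      show a + (b + 1) = a + 1 + b by ring]
    ring

/-- The function `u_k = B^k 1`, where the operator acts on row vectors. -/
noncomputable def walk (k : ℕ) : I → ℝ := B.op^[k] fun _ => 1

theorem walk_zero : B.walk 0 = fun _ => 1 := rfl

theorem walk_succ (k : ℕ) : B.walk (k + 1) = B.op (B.walk k) := Function.iterate_succ_apply' ..

theorem bddMeas_walk (k : ℕ) : BddMeas (B.walk k) := B.bddMeas_iterate (.const 1) k

/-- The squared norm of `B^k 1`. -/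
noncomputable def normSq (k : ℕ) : ℝ := ∫ x, B.walk k x ^ 2

/-- The row at `z` of the kernel of `B^(k+1)`. The index is shifted because the identity operator
`B^0` has no kernel. -/
noncomputable def power (k : ℕ) (z : I) : I → ℝ := B.op^[k] (B z)

theorem power_succ (k : ℕ) (z : I) : B.power (k + 1) z = B.op (B.power k z) :=
  Function.iterate_succ_apply' ..

theorem bddMeas_power_uncurry (k : ℕ) : BddMeas (Function.uncurry (B.power k)) :=
  B.bddMeas_iterate_uncurry B.bddMeas k

theorem bddMeas_row (z : I) : BddMeas (B z) := B.bddMeas.comp (by fun_prop : Measurable (z, ·))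

theorem bddMeas_col (y : I) : BddMeas fun x => B x y :=
  B.bddMeas_comp (u := fun x => x) measurable_id measurable_const

theorem bddMeas_power (k : ℕ) (z : I) : BddMeas (B.power k z) :=
  B.bddMeas_iterate (B.bddMeas_row z) k

/-- The squared Hilbert–Schmidt norm of `B^(k+1)`. -/
noncomputable def hsNormSq (k : ℕ) : ℝ := ∫ z, ∫ x, B.power k z x ^ 2

theorem integral_walk_mul_walk (a b : ℕ) :
    ∫ x, B.walk a x * B.walk b x = (-1) ^ a * ∫ x, B.walk (a + b) x := by
  simpa [walk] using B.integral_iterate_mul (.const 1) (.const 1) a b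

/-- Only the even powers of `B` contribute to the expansion; see also `integral_walk_odd`. -/
theorem integral_walk_even (k : ℕ) : ∫ x, B.walk (2 * k) x = (-1) ^ k * B.normSq k := by
  have h := B.integral_walk_mul_walk k k
  rw [← two_mul] at h
  simp only [normSq, pow_two, h]
  rw [← mul_assoc, ← pow_add, ← two_mul, pow_mul]
  simp

theorem integral_walk_odd (k : ℕ) : ∫ x, B.walk (2 * k + 1) x = 0 := by
  have h1 := B.integral_walk_mul_walk k (k + 1)
  have h2 := B.integral_walk_mul_walk (k + 1) k
  simp only [mul_comm (B.walk (k + 1) _)] at h2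
  rw [h1, pow_succ, show k + 1 + k = 2 * k + 1 by ring, show k + (k + 1) = 2 * k + 1 by ring] at h2
  rcases neg_one_pow_eq_or ℝ k with h | h <;> rw [h] at h2 <;> linarith

theorem integral_power (k : ℕ) (z : I) :
    ∫ x, B.power k z x = (-1) ^ (k + 1) * B.walk (k + 1) z := by
  have h' := B.integral_iterate_mul (.const 1) (B.bddMeas_row z) k 0
  simp only [Function.iterate_zero, id, add_zero, one_mul] at h'
  rw [power]
  have e : ∫ x, B.op^[k] (fun _ => 1) x * B z x = -B.walk (k + 1) z := by
    rw [walk_succ, op, ← integral_neg]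
    refine integral_congr_ae (.of_forall fun x => ?_)
    simp only [B.skew x z, walk]
    ring
  rw [e] at h'
  rw [pow_succ]
  rcases neg_one_pow_eq_or ℝ k with h | h <;> rw [h] at h' ⊢ <;> linarith

/-- The trace of `B^(2h+2)` is, up to its sign, the squared Hilbert–Schmidt norm of `B^(h+1)`. -/
theorem integral_power_diag (h : ℕ) :
    ∫ z, B.power (2 * h + 1) z z = (-1) ^ (h + 1) * B.hsNormSq h := by
  have e : ∀ z, B.power (2 * h + 1) z z = (-1) ^ (h + 1) * ∫ x, B.power h z x ^ 2 := fun z => by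
    have h0 := B.integral_iterate_mul (B.bddMeas_row z) (B.bddMeas_row z) h h
    rw [← two_mul] at h0
    have h1 : ∫ x, B z x * B.op^[2 * h] (B z) x = -B.power (2 * h + 1) z z := by
      rw [power_succ, op, ← integral_neg]
      refine integral_congr_ae (.of_forall fun x => ?_)
      simp only [B.skew x z, power]
      ring
    rw [h1] at h0
    simp only [pow_two, power] at h0 ⊢
    rw [h0, pow_succ]
    rcases neg_one_pow_eq_or ℝ h with h | h <;> rw [h] <;> ring
  simp only [e, integral_const_mul, hsNormSq]

end SkewKernel

/-! ### The trace expansion -/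

/-- The real sign encoded by a Boolean. -/
def sgn (R : Type*) [Ring R] (s : Bool) : R := if s then 1 else -1

/-- The formal expansion of `⟨u_a, ∏ (J + s B) u_p⟩`, up to the sign `(-1)^a`, in terms of
`m k = ⟨1, B^k 1⟩`, where `J` is the all-one kernel and `u_k = B^k 1`. -/
def openSum {R : Type*} [CommRing R] (m : ℕ → R) : List Bool → ℕ → ℕ → R
  | [], a, p => m (a + p)
  | s :: l, a, p => m p * openSum m l a 0 + sgn R s * openSum m l a (p + 1)

/-- The formal expansion of the trace of `B^k ∏ (J + s B)` in terms of `m k = ⟨1, B^k 1⟩` and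
`c k = tr B^k`, where `J` is the all-one kernel. -/
def closedSum {R : Type*} [CommRing R] (m c : ℕ → R) : List Bool → ℕ → R
  | [], k => c k
  | s :: l, k => openSum m l k 0 + sgn R s * closedSum m c l (k + 1)

namespace SkewKernel

variable (B : SkewKernel)

/-- The kernel `J + s B`, twice a tournamenton. -/
def edge (s : Bool) (x y : I) : ℝ := 1 + sgn ℝ s * B x y

theorem bddMeas_edge {α : Type*} [MeasurableSpace α] {u v : α → I} (hu : Measurable u)
    (hv : Measurable v) (s : Bool) : BddMeas fun a => B.edge s (u a) (v a) :=
  (BddMeas.const 1).add ((B.bddMeas_comp hu hv).const_mul _)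

theorem bddMeas_edge_row (s : Bool) (z : I) : BddMeas (B.edge s z) :=
  B.bddMeas_edge (u := fun _ => z) (v := fun x => x) measurable_const measurable_id s

theorem bddMeas_edge_col (s : Bool) (z : I) : BddMeas fun x => B.edge s x z :=
  B.bddMeas_edge (u := fun x => x) (v := fun _ => z) measurable_id measurable_const s

/-- The product of the operators with kernels `J + s B`, acting on row vectors. -/
noncomputable def transport : List Bool → (I → ℝ) → I → ℝ
  | [], f => f
  | s :: l, f => transport l fun y => ∫ x, f x * B.edge s x y

variable {α : Type*} [MeasurableSpace α]

theorem bddMeas_integral_edge_uncurry {F : α → I → ℝ} (hF : BddMeas (Function.uncurry F))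
    (s : Bool) : BddMeas (Function.uncurry fun a y => ∫ x, F a x * B.edge s x y) := by
  refine BddMeas.integral (F := fun (p : α × I) x => F p.1 x * B.edge s x p.2) ?_
  exact (hF.comp (u := fun q : (α × I) × I => (q.1.1, q.2)) (by fun_prop)).mul
    (B.bddMeas_edge (by fun_prop) (by fun_prop) s)

theorem bddMeas_integral_edge {f : I → ℝ} (hf : BddMeas f) (s : Bool) :
    BddMeas fun y => ∫ x, f x * B.edge s x y :=
  (B.bddMeas_integral_edge_uncurry (α := Unit) (F := fun _ => f) (hf.comp measurable_snd) s).comp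
    (u := fun y => ((), y)) (by fun_prop)

theorem bddMeas_transport_uncurry (l : List Bool) {F : α → I → ℝ}
    (hF : BddMeas (Function.uncurry F)) :
    BddMeas (Function.uncurry fun a => B.transport l (F a)) := by
  induction l generalizing F with
  | nil => exact hF
  | cons s l ih => exact ih (B.bddMeas_integral_edge_uncurry hF s)

theorem bddMeas_transport (l : List Bool) {f : I → ℝ} (hf : BddMeas f) :
    BddMeas (B.transport l f) := by
  induction l generalizing f with
  | nil => exact hf
  | cons s l ih => exact ih (B.bddMeas_integral_edge hf s)

theorem integral_edge {f : I → ℝ} (hf : BddMeas f) (s : Bool) (y : I) :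
    ∫ x, f x * B.edge s x y = (∫ x, f x) * 1 + sgn ℝ s * B.op f y := by
  have h : ∀ x, f x * B.edge s x y = f x + sgn ℝ s * (f x * B x y) := fun x => by
    rw [edge]; ring
  simp only [h]
  rw [integral_add hf.integrable ((hf.mul (B.bddMeas_col y)).const_mul _).integrable,
    integral_const_mul, op, mul_one]

theorem transport_linear (l : List Bool) {f g : I → ℝ} (hf : BddMeas f) (hg : BddMeas g)
    (c d : ℝ) : B.transport l (fun x => c * f x + d * g x) =
      fun x => c * B.transport l f x + d * B.transport l g x := by
  induction l generalizing f g with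
  | nil => rfl
  | cons s l ih =>
    simp only [transport]
    rw [← ih (B.bddMeas_integral_edge hf s) (B.bddMeas_integral_edge hg s)]
    congr 1
    funext y
    rw [← integral_const_mul, ← integral_const_mul, ← integral_add]
    · exact integral_congr_ae (.of_forall fun x => by ring)
    · exact ((hf.mul (B.bddMeas_edge_col s y)).const_mul c).integrable
    · exact ((hg.mul (B.bddMeas_edge_col s y)).const_mul d).integrable

theorem transport_cons (s : Bool) (l : List Bool) {f : I → ℝ} (hf : BddMeas f) :
    B.transport (s :: l) f = fun x => (∫ y, f y) * B.transport l (fun _ => 1) x +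
      sgn ℝ s * B.transport l (B.op f) x := by
  rw [← B.transport_linear l (.const 1) (B.bddMeas_op hf), transport]
  congr 1
  funext y
  exact B.integral_edge hf s y

theorem integral_walk_mul_transport (l : List Bool) (a p : ℕ) :
    ∫ x, B.walk a x * B.transport l (B.walk p) x =
      (-1) ^ a * openSum (fun k => ∫ x, B.walk k x) l a p := by
  induction l generalizing p with
  | nil => exact B.integral_walk_mul_walk a p
  | cons s l ih =>
    rw [B.transport_cons s l (B.bddMeas_walk p), ← walk_succ, openSum]
    have h : ∀ x, B.walk a x * ((∫ y, B.walk p y) * B.transport l (fun _ => 1) x +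
        sgn ℝ s * B.transport l (B.walk (p + 1)) x) =
        (∫ y, B.walk p y) * (B.walk a x * B.transport l (B.walk 0) x) +
        sgn ℝ s * (B.walk a x * B.transport l (B.walk (p + 1)) x) := fun x => by
      rw [walk_zero]; ring
    simp only [h]
    rw [integral_add
      (((B.bddMeas_walk a).mul (B.bddMeas_transport l (B.bddMeas_walk 0))).const_mul _).integrable
      (((B.bddMeas_walk a).mul (B.bddMeas_transport l
        (B.bddMeas_walk (p + 1)))).const_mul _).integrable,
      integral_const_mul, integral_const_mul, ih, ih]
    ring

theorem integral_transport_power (l : List Bool) (k : ℕ) :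
    ∫ z, B.transport l (B.power k z) z =
      closedSum (fun k => ∫ x, B.walk k x) (fun k => ∫ z, B.power (k - 1) z z) l (k + 1) := by
  induction l generalizing k with
  | nil => rfl
  | cons s l ih =>
    have h : ∀ z, B.transport (s :: l) (B.power k z) z =
        (-1) ^ (k + 1) * (B.walk (k + 1) z * B.transport l (B.walk 0) z) +
        sgn ℝ s * B.transport l (B.power (k + 1) z) z := fun z => by
      rw [B.transport_cons s l (B.bddMeas_power k z), ← power_succ, integral_power, walk_zero]
      ring
    simp only [h]
    rw [integral_add
      (((B.bddMeas_walk _).mul (B.bddMeas_transport l (B.bddMeas_walk 0))).const_mul _).integrable,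
      integral_const_mul, integral_const_mul, ih, B.integral_walk_mul_transport, ← mul_assoc,
      ← pow_add, ← two_mul, pow_mul, closedSum]
    · simp
    · exact ((B.bddMeas_transport_uncurry l (B.bddMeas_power_uncurry (k + 1))).comp
        (u := fun z => (z, z)) (by fun_prop)).const_mul _ |>.integrable

/-- The trace of `∏ (J + s B)`, as an expansion in the numbers `⟨1, B^k 1⟩` and `tr B^k`. -/
theorem integral_transport_edge (s : Bool) (l : List Bool) :
    ∫ z, B.transport l (B.edge s z) z =
      closedSum (fun k => ∫ x, B.walk k x) (fun k => ∫ z, B.power (k - 1) z z) (s :: l) 0 := by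
  have h : ∀ z, B.transport l (B.edge s z) z =
      B.walk 0 z * B.transport l (B.walk 0) z + sgn ℝ s * B.transport l (B.power 0 z) z :=
    fun z => by
      have := congrFun (B.transport_linear l (.const 1) (B.bddMeas_row z) 1 (sgn ℝ s)) z
      simp only [mul_one] at this
      change B.transport l (fun y => 1 + sgn ℝ s * B z y) z = _
      rw [this, walk_zero, one_mul]
      rfl
  simp only [h]
  rw [integral_add ((B.bddMeas_walk _).mul (B.bddMeas_transport l (B.bddMeas_walk 0))).integrable,
    integral_const_mul, B.integral_transport_power, B.integral_walk_mul_transport, closedSum]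
  · simp
  · exact ((B.bddMeas_transport_uncurry l (B.bddMeas_power_uncurry 0)).comp
      (u := fun z => (z, z)) (by fun_prop)).const_mul _ |>.integrable

theorem piFinSuccAbove_symm_apply {n : ℕ} (p : I × (Fin n → I)) :
    (MeasurableEquiv.piFinSuccAbove (fun _ : Fin (n + 1) => I) 0).symm p =
      (Fin.cons p.1 p.2 : Fin (n + 1) → I) := by
  simp [MeasurableEquiv.piFinSuccAbove, Fin.insertNthEquiv]

theorem measurable_cons {n : ℕ} :
    Measurable fun p : I × (Fin n → I) => (Fin.cons p.1 p.2 : Fin (n + 1) → I) := by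
  simp only [← piFinSuccAbove_symm_apply]
  exact (MeasurableEquiv.piFinSuccAbove (fun _ : Fin (n + 1) => I) 0).symm.measurable

theorem integral_pi_cons {n : ℕ} {F : (Fin (n + 1) → I) → ℝ} (hF : BddMeas F) :
    ∫ x, F x = ∫ z, ∫ x : Fin n → I, F (Fin.cons z x) := by
  have h := (volume_preserving_piFinSuccAbove (fun _ : Fin (n + 1) => I) 0).symm
  rw [← h.integral_comp', Measure.volume_eq_prod, integral_prod]
  · simp only [piFinSuccAbove_symm_apply]
  · exact (hF.comp h.measurable).integrable

/-- Integrating out the vertices of a path one after the other. -/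
theorem integral_path (n : ℕ) (s : Fin n → Bool) {f g : I → ℝ} (hf : BddMeas f)
    (hg : BddMeas g) :
    ∫ x : Fin (n + 1) → I, f (x 0) * (∏ i : Fin n, B.edge (s i) (x i.castSucc) (x i.succ)) *
      g (x (Fin.last n)) = ∫ y, B.transport (List.ofFn s) f y * g y := by
  induction n generalizing f with
  | zero =>
    have hF : BddMeas fun x : Fin 1 → I => f (x 0) * g (x 0) :=
      (hf.mul hg).comp (measurable_pi_apply 0)
    simpa [transport] using integral_pi_cons hF
  | succ n ih =>
    have hR : BddMeas fun x : Fin (n + 1) → I =>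
        (∏ i : Fin n, B.edge (s i.succ) (x i.castSucc) (x i.succ)) * g (x (Fin.last n)) :=
      (BddMeas.prod _ fun i => B.bddMeas_edge (by fun_prop) (by fun_prop) _).mul
        (hg.comp (by fun_prop))
    have hF : BddMeas fun x : Fin (n + 2) → I =>
        f (x 0) * (∏ i : Fin (n + 1), B.edge (s i) (x i.castSucc) (x i.succ)) *
          g (x (Fin.last (n + 1))) :=
      ((hf.comp (measurable_pi_apply 0)).mul
        (BddMeas.prod _ fun i => B.bddMeas_edge (by fun_prop) (by fun_prop) _)).mul
        (hg.comp (by fun_prop))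
    rw [integral_pi_cons hF, BddMeas.integral_swap (hF.comp measurable_cons)]
    · rw [List.ofFn_succ, transport, ← ih (fun i => s i.succ) (B.bddMeas_integral_edge hf (s 0))]
      refine integral_congr_ae (.of_forall fun x => ?_)
      simp only
      rw [mul_assoc, ← integral_mul_const]
      refine integral_congr_ae (.of_forall fun z => ?_)
      simp only [Fin.prod_univ_succ, Fin.castSucc_zero, Fin.cons_zero, Fin.cons_succ,
        ← Fin.succ_last, ← Fin.succ_castSucc]
      ring

theorem transport_append_singleton (l : List Bool) (s : Bool) (f : I → ℝ) :
    B.transport (l ++ [s]) f = fun y => ∫ x, B.transport l f x * B.edge s x y := by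
  induction l generalizing f with
  | nil => rfl
  | cons t l ih => exact ih _

/-- The integral over all closed walks is a trace. -/
theorem integral_cycle (n : ℕ) (s : Fin (n + 2) → Bool) :
    ∫ x : Fin (n + 2) → I, ∏ i, B.edge (s i) (x i) (x (i + 1)) =
      closedSum (fun k => ∫ x, B.walk k x) (fun k => ∫ z, B.power (k - 1) z z)
        (List.ofFn s) 0 := by
  rw [List.ofFn_succ, ← B.integral_transport_edge, integral_pi_cons]
  · refine integral_congr_ae (.of_forall fun z => ?_)
    simp only
    rw [List.ofFn_succ', List.concat_eq_append, B.transport_append_singleton]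
    beta_reduce
    rw [← B.integral_path n _ (B.bddMeas_edge_row (s 0) z) (B.bddMeas_edge_col _ z)]
    refine integral_congr_ae (.of_forall fun x => ?_)
    simp only
    rw [Fin.prod_univ_succ, Fin.prod_univ_castSucc, ← mul_assoc]
    simp only [Fin.cons_zero, zero_add, Fin.succ_last]
    congr 1
    · congr 1
      refine Finset.prod_congr rfl fun i _ => ?_
      have h2 : i.castSucc.succ + 1 = i.succ.succ := by
        ext
        simp [Fin.val_add, Nat.mod_eq_of_lt]
      rw [h2, Fin.cons_succ, Fin.cons_succ]
    · have h3 : Fin.last (n + 1) + 1 = 0 := Fin.last_add_one _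
      rw [h3, ← Fin.succ_last, Fin.cons_succ, Fin.cons_zero]
  · exact BddMeas.prod _ fun i => B.bddMeas_edge (by fun_prop) (by fun_prop) _

end SkewKernel

/-! ### Densities of oriented cycles in tournamentons -/

/-- The skew-symmetric kernel `2W - 1` of a tournamenton `W`. -/
def Tournamenton.skewKernel (W : Tournamenton) : SkewKernel where
  toFun x y := 2 * W.toFun x y - 1
  measurable_toFun := (W.measurable_toFun.const_mul 2).sub_const 1
  abs_le_one x y := by
    have h := W.add_swap x y
    have h1 := W.nonneg x y
    have h2 := W.nonneg y x
    rw [abs_le]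
    constructor <;> linarith
  skew x y := by linarith [W.add_swap x y]

/-- The tournamenton `(1 + B) / 2` of a skew-symmetric kernel `B`. -/
noncomputable def SkewKernel.tournamenton (B : SkewKernel) : Tournamenton where
  toFun x y := (1 + B x y) / 2
  measurable_toFun := (B.measurable_toFun.const_add 1).div_const 2
  nonneg x y := by linarith [neg_le_of_abs_le (B.abs_le_one x y)]
  add_swap x y := by linarith [B.skew x y]

theorem SkewKernel.ext {A B : SkewKernel} (h : ∀ x y, A x y = B x y) : A = B := by
  obtain ⟨f, _, _, _⟩ := A
  obtain ⟨g, _, _, _⟩ := B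
  obtain rfl : f = g := funext fun x => funext fun y => h x y
  rfl

theorem SkewKernel.skewKernel_tournamenton (B : SkewKernel) : B.tournamenton.skewKernel = B :=
  SkewKernel.ext fun x y => by simp only [Tournamenton.skewKernel, SkewKernel.tournamenton]; ring

section

variable {n : ℕ}

theorem cycleOfSigns_adj (s : Fin (n + 1) → Bool) (v w : Fin (n + 1)) :
    (cycleOfSigns s).Adj v w ↔ (w = v + 1 ∧ s v = true) ∨ (v = w + 1 ∧ s w = false) := by
  have h : ∀ v w : Fin (n + 1), w = v + 1 ↔ (w : ℕ) = ((v : ℕ) + 1) % (n + 1) := fun v w => by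
    rw [Fin.ext_iff, Fin.val_add, Fin.val_one', Nat.add_mod_mod]
  rw [h, h]
  rfl

/-- The two neighbours of a vertex of a cycle of length at least three are distinct. -/
theorem fin_ne_add_one_add_one (i : Fin (n + 3)) : i ≠ i + 1 + 1 := by
  intro h
  rw [add_assoc, left_eq_add, Fin.ext_iff, Fin.val_add] at h
  rcases n with _ | n
  · simp at h
  · simp [Nat.mod_eq_of_lt] at h

/-- The arc of `cycleOfSigns s` between `i` and `i + 1`. -/
def signArc (s : Fin (n + 3) → Bool) (i : Fin (n + 3)) : Fin (n + 3) × Fin (n + 3) :=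
  if s i then (i, i + 1) else (i + 1, i)

theorem signArc_injective (s : Fin (n + 3) → Bool) : Function.Injective (signArc s) := by
  intro i j h
  unfold signArc at h
  split_ifs at h <;> simp only [Prod.mk.injEq] at h
  · exact h.1
  · obtain ⟨h1, rfl⟩ := h
    exact absurd h1 (fin_ne_add_one_add_one i)
  · obtain ⟨rfl, h2⟩ := h
    exact absurd h2 (fin_ne_add_one_add_one i)
  · exact h.2

theorem arcs_cycleOfSigns (s : Fin (n + 3) → Bool) :
    arcs (cycleOfSigns s) = Finset.univ.image (signArc s) := by
  ext ⟨v, w⟩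
  simp only [arcs, Set.Finite.mem_toFinset, Set.mem_ofPred_eq, cycleOfSigns_adj, Finset.mem_image,
    Finset.mem_univ, true_and, signArc]
  constructor
  · rintro (⟨rfl, h⟩ | ⟨rfl, h⟩)
    · exact ⟨v, by simp [h]⟩
    · exact ⟨w, by simp [h]⟩
  · rintro ⟨i, h⟩
    split_ifs at h with hi <;> obtain ⟨rfl, rfl⟩ := Prod.mk.inj h
    · exact .inl ⟨rfl, hi⟩
    · exact .inr ⟨rfl, by simpa using hi⟩

theorem card_arcs_cycleOfSigns (s : Fin (n + 3) → Bool) : (arcs (cycleOfSigns s)).card = n + 3 := by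
  rw [arcs_cycleOfSigns, Finset.card_image_of_injective _ (signArc_injective s)]
  simp

/-- The density of an oriented cycle, relative to its density in the constant tournamenton. -/
noncomputable def SkewKernel.cycleSum (B : SkewKernel) (l : List Bool) : ℝ :=
  closedSum (fun k => ∫ x, B.walk k x) (fun k => ∫ z, B.power (k - 1) z z) l 0

theorem homDensity_cycleOfSigns (W : Tournamenton) (s : Fin (n + 3) → Bool) :
    homDensity (cycleOfSigns s) W.toFun =
      (1 / 2 : ℝ) ^ (n + 3) * W.skewKernel.cycleSum (List.ofFn s) := by
  rw [SkewKernel.cycleSum, ← SkewKernel.integral_cycle, homDensity, ← integral_const_mul]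
  refine integral_congr_ae (.of_forall fun x => ?_)
  simp only
  rw [arcs_cycleOfSigns, Finset.prod_image fun i _ j _ h => signArc_injective s h]
  have hc : (1 / 2 : ℝ) ^ (n + 3) = ∏ _i : Fin (n + 3), (1 / 2 : ℝ) := by simp
  rw [hc, ← Finset.prod_mul_distrib]
  refine Finset.prod_congr rfl fun i _ => ?_
  have h := W.add_swap (x i) (x (i + 1))
  unfold signArc SkewKernel.edge Tournamenton.skewKernel sgn
  split_ifs
  · ring
  · simp only
    linarith

theorem isQuasirandomForcing_cycleOfSigns_iff (s : Fin (n + 3) → Bool) :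
    IsQuasirandomForcing (cycleOfSigns s) ↔ ∀ B : SkewKernel, B.cycleSum (List.ofFn s) = 1 →
      ∀ᵐ p : I × I, B p.1 p.2 = 0 := by
  have hpos : (0 : ℝ) < (1 / 2 : ℝ) ^ (n + 3) := by positivity
  constructor
  · intro h B hB
    have := h B.tournamenton
    rw [homDensity_cycleOfSigns, card_arcs_cycleOfSigns, B.skewKernel_tournamenton, hB,
      mul_one] at this
    filter_upwards [this rfl] with p hp
    simp only [SkewKernel.tournamenton] at hp
    linarith
  · intro h W hW
    rw [homDensity_cycleOfSigns, card_arcs_cycleOfSigns] at hW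
    filter_upwards [h W.skewKernel (mul_left_cancel₀ hpos.ne' (by rw [hW, mul_one]))] with p hp
    simp only [Tournamenton.skewKernel] at hp
    linarith

end

/-! ### Inequalities between norms -/

namespace SkewKernel

variable (B : SkewKernel)

theorem normSq_zero : B.normSq 0 = 1 := by simp [normSq, walk]

theorem normSq_nonneg (k : ℕ) : 0 ≤ B.normSq k := integral_nonneg fun _ => sq_nonneg _

theorem hsNormSq_nonneg (k : ℕ) : 0 ≤ B.hsNormSq k :=
  integral_nonneg fun _ => integral_nonneg fun _ => sq_nonneg _

theorem integral_op_sq {f : I → ℝ} (hf : BddMeas f) :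
    ∫ x, B.op f x ^ 2 = -∫ x, f x * B.op (B.op f) x := by
  rw [← B.integral_op_mul hf (B.bddMeas_op hf)]
  simp only [pow_two]

/-- The norms of `B^k f` form a logarithmically convex sequence. -/
theorem integral_iterate_sq_sq_le {f : I → ℝ} (hf : BddMeas f) (k : ℕ) :
    (∫ x, B.op^[k + 1] f x ^ 2) ^ 2 ≤
      (∫ x, B.op^[k] f x ^ 2) * ∫ x, B.op^[k + 2] f x ^ 2 := by
  have hk := B.bddMeas_iterate hf k
  simp only [Function.iterate_succ_apply']
  rw [B.integral_op_sq hk, neg_sq]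
  exact integral_mul_sq_le hk (B.bddMeas_op (B.bddMeas_op hk))

theorem normSq_sq_le (k : ℕ) : B.normSq (k + 1) ^ 2 ≤ B.normSq k * B.normSq (k + 2) :=
  B.integral_iterate_sq_sq_le (.const 1) k

/-- As the kernel is skew-symmetric, its singular values come in pairs, so its operator norm is
at most the Hilbert–Schmidt norm divided by `√2`. -/
theorem integral_op_sq_le {f : I → ℝ} (hf : BddMeas f) :
    ∫ x, B.op f x ^ 2 ≤ (∫ x, f x ^ 2) / 2 := by
  have hw := B.bddMeas_op hf
  set w := B.op f with hwdef
  set N := ∫ x, w x ^ 2 with hN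
  set F := ∫ x, f x ^ 2 with hF
  have hN0 : 0 ≤ N := integral_nonneg fun _ => sq_nonneg _
  have hF0 : 0 ≤ F := integral_nonneg fun _ => sq_nonneg _
  have f1 : BddMeas fun p : I × I => f p.1 := hf.comp measurable_fst
  have f2 : BddMeas fun p : I × I => f p.2 := hf.comp measurable_snd
  have w1 : BddMeas fun p : I × I => w p.1 := hw.comp measurable_fst
  have w2 : BddMeas fun p : I × I => w p.2 := hw.comp measurable_snd
  have hB : BddMeas fun p : I × I => B p.1 p.2 := B.bddMeas
  have e1 : ∫ p : I × I, B p.1 p.2 * (f p.1 * w p.2) = N := by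
    rw [Measure.volume_eq_prod, integral_prod_symm _ (hB.mul (f1.mul w2)).integrable, hN]
    refine integral_congr_ae (.of_forall fun y => ?_)
    simp only
    rw [pow_two]
    nth_rw 2 [hwdef]
    rw [op, ← integral_mul_const]
    exact integral_congr_ae (.of_forall fun x => by ring)
  have e2 : ∫ p : I × I, B p.1 p.2 * (f p.2 * w p.1) = -N := by
    rw [← e1, ← integral_neg, Measure.volume_eq_prod,
      ← integral_prod_swap fun p : I × I => -(B p.1 p.2 * (f p.1 * w p.2))]
    refine integral_congr_ae (.of_forall fun p => ?_)
    simp only [Prod.fst_swap, Prod.snd_swap, B.skew p.1 p.2]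
    ring
  have e3 : ∫ p : I × I, B p.1 p.2 * (f p.1 * w p.2 - f p.2 * w p.1) = 2 * N := by
    simp only [mul_sub]
    rw [integral_sub (hB.mul (f1.mul w2)).integrable (hB.mul (f2.mul w1)).integrable, e1, e2]
    ring
  have e4 : ∫ p : I × I, (f p.1 * w p.2 - f p.2 * w p.1) ^ 2 =
      2 * (F * N) - 2 * (∫ x, f x * w x) ^ 2 := by
    have : ∀ p : I × I, (f p.1 * w p.2 - f p.2 * w p.1) ^ 2 =
        (f p.1 ^ 2 * w p.2 ^ 2 - 2 * ((f p.1 * w p.1) * (f p.2 * w p.2))) +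
          w p.1 ^ 2 * f p.2 ^ 2 := fun p => by ring
    simp only [this]
    rw [integral_add ((((f1.pow 2).mul (w2.pow 2)).sub
      (((f1.mul w1).mul (f2.mul w2)).const_mul 2)).integrable)
      ((w1.pow 2).mul (f2.pow 2)).integrable,
      integral_sub ((f1.pow 2).mul (w2.pow 2)).integrable
        (((f1.mul w1).mul (f2.mul w2)).const_mul 2).integrable, integral_const_mul,
      Measure.volume_eq_prod, integral_prod_mul (fun x => f x ^ 2) (fun x => w x ^ 2),
      integral_prod_mul (fun x => f x * w x) (fun x => f x * w x),
      integral_prod_mul (fun x => w x ^ 2) (fun x => f x ^ 2)]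
    ring
  have e5 : ∫ p : I × I, B p.1 p.2 ^ 2 ≤ 1 := by
    have : ∫ p : I × I, B p.1 p.2 ^ 2 ≤ ∫ _p : I × I, (1 : ℝ) :=
      integral_mono (hB.pow 2).integrable (BddMeas.const 1).integrable fun p => by
        simpa using (sq_le_one_iff_abs_le_one _).2 (B.abs_le_one p.1 p.2)
    simpa using this
  have cs := integral_mul_sq_le (μ := (volume : Measure (I × I))) hB ((f1.mul w2).sub (f2.mul w1))
  rw [e3, e4] at cs
  have h4 : (2 * N) ^ 2 ≤ 2 * (F * N) := by
    have h0 : 0 ≤ 2 * (F * N) - 2 * (∫ x, f x * w x) ^ 2 := by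
      rw [← e4]; exact integral_nonneg fun _ => sq_nonneg _
    nlinarith [sq_nonneg (∫ x, f x * w x)]
  rcases hN0.eq_or_lt with h | h
  · rw [← h]; linarith
  · nlinarith

theorem normSq_succ_le (k : ℕ) : B.normSq (k + 1) ≤ B.normSq k / 2 := by
  simpa only [normSq, walk_succ] using B.integral_op_sq_le (B.bddMeas_walk k)

/-- For all `x, y, z`, the sum of `B(x,y) B(y,z)` and its two cyclic shifts is at least `-1`, and
the integral of each of the three products is `-‖B 1‖²`. -/
theorem normSq_one_le : B.normSq 1 ≤ 1 / 3 := by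
  have hm2 : ∫ x, B.op (B.walk 1) x = -B.normSq 1 := by
    simpa [walk_succ] using B.integral_walk_even 1
  have hz : ∀ y, ∫ z, B y z = -B.walk 1 y := fun y => by
    simp only [walk_succ, walk_zero, op, one_mul, ← integral_neg]
    exact integral_congr_ae (.of_forall fun x => B.skew x y)
  have hz' : ∀ y, ∫ z, B z y = B.walk 1 y := fun y => by
    simp only [walk_succ, walk_zero, op, one_mul]
  have h3 : ∀ {α : Type} [MeasurableSpace α] {u v w : α → I}, Measurable u → Measurable v →
      Measurable w → BddMeas fun a => B (u a) (v a) * B (v a) (w a) := fun hu hv hw =>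
    (B.bddMeas_comp hu hv).mul (B.bddMeas_comp hv hw)
  have t1 : ∫ x, ∫ y, ∫ z, B x y * B y z = -B.normSq 1 := by
    rw [← hm2]
    refine integral_congr_ae (.of_forall fun x => ?_)
    refine integral_congr_ae (.of_forall fun y => ?_)
    simp only
    rw [integral_const_mul, hz, B.skew y x]
    ring
  have t2 : ∫ x, ∫ y, ∫ z, B y z * B z x = -B.normSq 1 := by
    rw [← hm2]
    refine integral_congr_ae (.of_forall fun x => ?_)
    simp only
    rw [BddMeas.integral_swap (h3 (by fun_prop) (by fun_prop) (by fun_prop)), op]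
    refine integral_congr_ae (.of_forall fun z => ?_)
    simp only
    rw [integral_mul_const, hz']
  have t3 : ∫ x, ∫ y, ∫ z, B z x * B x y = -B.normSq 1 := by
    rw [normSq, ← integral_neg]
    refine integral_congr_ae (.of_forall fun x => ?_)
    simp only [integral_mul_const, integral_const_mul, hz, hz']
    ring
  have b1 : BddMeas fun p : I × I × I => B p.1 p.2.1 * B p.2.1 p.2.2 :=
    h3 (by fun_prop) (by fun_prop) (by fun_prop)
  have b2 : BddMeas fun p : I × I × I => B p.2.1 p.2.2 * B p.2.2 p.1 :=
    h3 (by fun_prop) (by fun_prop) (by fun_prop)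
  have b3 : BddMeas fun p : I × I × I => B p.2.2 p.1 * B p.1 p.2.1 :=
    h3 (by fun_prop) (by fun_prop) (by fun_prop)
  have conv : ∀ {F : I × I × I → ℝ}, BddMeas F → ∫ p, F p = ∫ x, ∫ y, ∫ z, F (x, y, z) := by
    intro F hF
    rw [Measure.volume_eq_prod, integral_prod _ hF.integrable]
    refine integral_congr_ae (.of_forall fun x => ?_)
    simp only
    rw [Measure.volume_eq_prod, integral_prod _ (hF.comp (by fun_prop :
      Measurable fun q : I × I => (x, q))).integrable]
  have key : ∫ _p : I × I × I, (-1 : ℝ) ≤ ∫ p : I × I × I, (B p.1 p.2.1 * B p.2.1 p.2.2 +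
      B p.2.1 p.2.2 * B p.2.2 p.1 + B p.2.2 p.1 * B p.1 p.2.1) := by
    refine integral_mono (BddMeas.const _).integrable ((b1.add b2).add b3).integrable fun p => ?_
    have ha := abs_le.1 (B.abs_le_one p.1 p.2.1)
    have hb := abs_le.1 (B.abs_le_one p.2.1 p.2.2)
    have hc := abs_le.1 (B.abs_le_one p.2.2 p.1)
    simp only
    nlinarith [mul_nonneg (mul_nonneg (sub_nonneg.2 ha.2) (sub_nonneg.2 hb.2))
        (sub_nonneg.2 hc.2), mul_nonneg (mul_nonneg (neg_le_iff_add_nonneg.1 ha.1)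
        (neg_le_iff_add_nonneg.1 hb.1)) (neg_le_iff_add_nonneg.1 hc.1)]
  rw [integral_add (b1.add b2).integrable b3.integrable, integral_add b1.integrable b2.integrable,
    conv b1, conv b2, conv b3, t1, t2, t3] at key
  simp at key
  linarith

/-- A skew-symmetric kernel whose operator annihilates all bounded functions vanishes. -/
theorem ae_eq_zero_of_op_eq_zero (h : ∀ f, BddMeas f → ∀ᵐ y, B.op f y = 0) :
    ∀ᵐ p : I × I, B p.1 p.2 = 0 := by
  have hint : Integrable (Function.uncurry B) (volume : Measure (I × I)) := B.bddMeas.integrable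
  have hrect : ∀ S T : Set I, MeasurableSet S → MeasurableSet T →
      ∫ p in S ×ˢ T, Function.uncurry B p = 0 := by
    intro S T hS hT
    have hf : BddMeas (S.indicator fun _ => (1 : ℝ)) :=
      ⟨measurable_const.indicator hS, 1, fun x => by
        by_cases hx : x ∈ S <;> simp [hx]⟩
    rw [Measure.volume_eq_prod, ← Measure.prod_restrict, integral_prod_symm _
      B.bddMeas.integrable]
    refine integral_eq_zero_of_ae (ae_restrict_of_ae ?_)
    filter_upwards [h _ hf] with y hy
    rw [op] at hy
    rw [Pi.zero_apply, ← hy, ← integral_indicator hS]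
    refine integral_congr_ae (.of_forall fun x => ?_)
    by_cases hx : x ∈ S <;> simp [hx]
  have hall : ∀ E : Set (I × I), MeasurableSet E → ∫ p in E, Function.uncurry B p = 0 := by
    intro E hE
    induction E, hE using MeasurableSpace.induction_on_inter generateFrom_prod.symm
      isPiSystem_prod with
    | empty => simp
    | basic E hE =>
      obtain ⟨S, hS, T, hT, rfl⟩ := hE
      exact hrect S T hS hT
    | compl E hE ih =>
      have h0 := hrect Set.univ Set.univ .univ .univ
      rw [Set.univ_prod_univ, Measure.restrict_univ] at h0
      rw [setIntegral_compl hE hint, h0, ih, sub_zero]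
    | iUnion f hd hm ih =>
      rw [integral_iUnion hm hd hint.integrableOn]
      simp [ih]
  exact hint.ae_eq_zero_of_forall_setIntegral_eq_zero fun E hE _ => hall E hE

/-- By logarithmic convexity, a power of `B` can annihilate `f` only if `B` does. -/
theorem integral_op_sq_eq_zero_of_iterate {f : I → ℝ} (hf : BddMeas f) (k : ℕ)
    (h : ∫ x, B.op^[k + 1] f x ^ 2 = 0) : ∫ x, B.op f x ^ 2 = 0 := by
  induction k with
  | zero => exact h
  | succ k ih =>
    refine ih ?_
    have := B.integral_iterate_sq_sq_le hf k
    rw [h, mul_zero] at this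
    exact pow_eq_zero_iff two_ne_zero |>.1 (le_antisymm this (sq_nonneg _))

theorem ae_eq_zero_of_integral_sq {f : I → ℝ} (hf : BddMeas f) (h : ∫ x, f x ^ 2 = 0) :
    ∀ᵐ x, f x = 0 := by
  filter_upwards [(integral_eq_zero_iff_of_nonneg (fun x => sq_nonneg (f x))
    (hf.pow 2).integrable).1 h] with x hx
  simpa using hx

/-- If a power of a skew-symmetric kernel vanishes, then so does the kernel. -/
theorem ae_eq_zero_of_hsNormSq_eq_zero (k : ℕ) (h : B.hsNormSq (k + 1) = 0) :
    ∀ᵐ p : I × I, B p.1 p.2 = 0 := by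
  have hsq : BddMeas (Function.uncurry fun z x => B.power (k + 1) z x ^ 2) :=
    (B.bddMeas_power_uncurry (k + 1)).pow 2
  have h1 : ∀ᵐ z, ∫ x, B.op (B z) x ^ 2 = 0 := by
    filter_upwards [(integral_eq_zero_iff_of_nonneg
      (fun z => integral_nonneg fun x => sq_nonneg (B.power (k + 1) z x))
      hsq.integral.integrable).1 h] with z hz
    exact B.integral_op_sq_eq_zero_of_iterate (B.bddMeas_row z) k hz
  refine B.ae_eq_zero_of_op_eq_zero fun f hf => ?_
  refine ae_eq_zero_of_integral_sq (B.bddMeas_op hf) ?_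
  rw [B.integral_op_sq hf, neg_eq_zero]
  refine integral_eq_zero_of_ae ?_
  filter_upwards [h1] with z hz
  -- `(B² f)(z)` is the integral of `f` against the row of `B²` at `z`, which vanishes.
  have hop : B.op (B.op f) z = ∫ x, B.op (B z) x * f x := by
    rw [B.integral_op_mul (B.bddMeas_row z) hf, op, ← integral_neg]
    refine integral_congr_ae (.of_forall fun x => ?_)
    simp only [B.skew x z]
    ring
  have h0 : ∫ x, B.op (B z) x * f x = 0 := by
    refine integral_eq_zero_of_ae ?_
    filter_upwards [ae_eq_zero_of_integral_sq (B.bddMeas_op (B.bddMeas_row z)) hz] with x hx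
    simp [hx]
  simp [hop, h0]

theorem normSq_one_eq_zero (h : ∀ᵐ p : I × I, B p.1 p.2 = 0) : B.normSq 1 = 0 := by
  refine integral_eq_zero_of_ae ?_
  rw [Measure.volume_eq_prod] at h
  filter_upwards [Measure.ae_ae_of_ae_prod h] with y hy
  have : B.walk 1 y = 0 := by
    rw [walk_succ, walk_zero, op]
    refine integral_eq_zero_of_ae ?_
    filter_upwards [hy] with x hx
    simp [B.skew y x, hx]
  simp [this]

end SkewKernel

/-! ### The density polynomial -/

/-- The numbers `⟨1, B^k 1⟩` in terms of the numbers `b j = ‖B^j 1‖²`. -/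
def walkSeq {R : Type*} [CommRing R] (b : ℕ → R) (k : ℕ) : R :=
  if k % 2 = 0 then (-1) ^ (k / 2) * b (k / 2) else 0

/-- The relative density of an oriented cycle of even length `2h` with signs `l`, as a polynomial
in the numbers `b j = ‖B^j 1‖²` and the squared Hilbert–Schmidt norm `t` of `B^h`. -/
def cyclePoly {R : Type*} [CommRing R] (b : ℕ → R) (t : R) (l : List Bool) : R :=
  closedSum (walkSeq b) (fun _ => (-1) ^ (l.length / 2) * t) l 0

theorem closedSum_const {R : Type*} [CommRing R] (m c : ℕ → R) (l : List Bool) (k : ℕ) :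
    closedSum m c l k = closedSum m (fun _ => c (l.length + k)) l k := by
  induction l generalizing k with
  | nil => simp [closedSum]
  | cons s l ih =>
    rw [closedSum, closedSum, ih (k + 1), List.length_cons, show l.length + 1 + k =
      l.length + (k + 1) by ring]

theorem SkewKernel.cycleSum_eq (B : SkewKernel) (l : List Bool) (h : ℕ)
    (hl : l.length = 2 * (h + 1)) : B.cycleSum l = cyclePoly B.normSq (B.hsNormSq h) l := by
  have h1 : (fun k => ∫ x, B.walk k x) = walkSeq B.normSq := by
    funext k
    rcases Nat.even_or_odd' k with ⟨j, rfl | rfl⟩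
    · rw [B.integral_walk_even, walkSeq, if_pos (by omega), Nat.mul_div_cancel_left _ two_pos]
    · rw [B.integral_walk_odd, walkSeq, if_neg (by omega)]
  rw [cycleSum, closedSum_const, h1, cyclePoly, hl, Nat.mul_div_cancel_left _ two_pos, add_zero,
    ← B.integral_power_diag]
  rfl

/-! ### Forcing orientations -/

/-- The constraints on the numbers `b j = ‖B^j 1‖²` that are used for the forcing orientations. -/
structure IsNormSeq (b : ℕ → ℝ) : Prop where
  zero : b 0 = 1
  nonneg : ∀ k, 0 ≤ b k
  one_le : b 1 ≤ 1 / 3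
  succ_le : ∀ k, b (k + 1) ≤ b k / 2
  sq_le : ∀ k, b (k + 1) ^ 2 ≤ b k * b (k + 2)

theorem SkewKernel.isNormSeq (B : SkewKernel) : IsNormSeq B.normSq where
  zero := B.normSq_zero
  nonneg := B.normSq_nonneg
  one_le := B.normSq_one_le
  succ_le := B.normSq_succ_le
  sq_le := B.normSq_sq_le

theorem IsNormSeq.walkSeq_values {b : ℕ → ℝ} (hb : IsNormSeq b) :
    walkSeq b 0 = 1 ∧ walkSeq b 1 = 0 ∧ walkSeq b 2 = -b 1 ∧ walkSeq b 3 = 0 ∧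
      walkSeq b 4 = b 2 ∧ walkSeq b 5 = 0 ∧ walkSeq b 6 = -b 3 ∧ walkSeq b 7 = 0 ∧
      walkSeq b 8 = b 4 ∧ walkSeq b 9 = 0 := by
  norm_num [walkSeq, hb.zero]

set_option maxHeartbeats 4000000 in
/-- The relative density of each of the listed orientations differs from one as soon as the
trace term does not vanish: the deviation from one without the trace term has the same sign as the
trace term, or vanishes. For the block lengths `3, 3, 1, 1, 1, 1` this bound is attained by the
moments of `2/3 δ_(1/2) + 1/3 δ_0`, hence the precise products of constraints in the proof. -/
theorem IsNormSeq.cyclePoly_ne_one {b : ℕ → ℝ} (hb : IsNormSeq b) {t : ℝ} (ht : 0 < t) {ℓ : ℕ}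
    (hℓ : ℓ ∈ ({4, 6, 8, 10} : Finset ℕ)) {a : List ℕ} (ha : a ∈ forcingTypes ℓ) :
    cyclePoly b t (blockSigns true a) ≠ 1 := by
  have b1 := hb.nonneg 1
  have b2 := hb.nonneg 2
  have b3 := hb.nonneg 3
  have b4 := hb.nonneg 4
  have l1 := hb.one_le
  have l2 := hb.succ_le 1
  have l3 := hb.succ_le 2
  have l4 := hb.succ_le 3
  have c1 := hb.sq_le 0
  have c2 := hb.sq_le 1
  have c3 := hb.sq_le 2
  rw [hb.zero, one_mul, zero_add, zero_add] at c1
  -- Products of the constraints, after which every case is a linear combination.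
  have m11 := mul_nonneg b1 b1
  have p11 := mul_nonneg b1 (sub_nonneg.2 l1)
  have p12 := mul_nonneg b1 (sub_nonneg.2 l2)
  have p13 := mul_nonneg b1 (sub_nonneg.2 l3)
  have c11 := mul_nonneg b1 (sub_nonneg.2 c1)
  -- The spectral measure `μ` of the constant function lives on `[0, 1/2]` and has the moments `b`;
  -- the next two inequalities state that `∫ x (1/2 - x)² dμ` and `∫ x² (1/2 - x)² dμ` are
  -- nonnegative.
  have a2 : b 2 ≤ b 1 / 4 + b 3 := abs_le_of_sq_le_sq' (by
    nlinarith [sq_nonneg (b 1 / 4 - b 3)]) (by linarith) |>.2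
  have a3 : b 3 ≤ b 2 / 4 + b 4 := abs_le_of_sq_le_sq' (by
    nlinarith [sq_nonneg (b 2 / 4 - b 4)]) (by linarith) |>.2
  have s11 := mul_nonneg b1 (sq_nonneg (1 / 3 - b 1))
  have s12 := mul_nonneg (sub_nonneg.2 l1) (sub_nonneg.2 l2)
  have s2 := sq_nonneg (b 2 - b 1 / 2)
  norm_num at l2 l3 l4 c2 c3 m11 p11 p12 p13 c11 s12
  obtain ⟨w0, w1, w2, w3, w4, w5, w6, w7, w8, w9⟩ := hb.walkSeq_values
  intro h
  simp only [Finset.mem_insert, Finset.mem_singleton] at hℓ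
  rcases hℓ with rfl | rfl | rfl | rfl <;>
  simp only [forcingTypes, List.mem_cons, List.not_mem_nil, or_false] at ha <;>
  casesm* _ ∨ _ <;>
  subst ha <;>
  simp only [blockSigns, List.replicate, Bool.not_true, Bool.not_false, List.cons_append,
    List.nil_append, List.append_nil, cyclePoly, List.length_cons, List.length_nil, closedSum,
    openSum, w0, w1, w2, w3, w4, w5, w6, w7, w8, w9, sgn, Nat.reduceAdd, Nat.reduceDiv, if_true,
    reduceIte, Bool.false_eq_true, zero_mul, one_mul, zero_add, add_zero, neg_mul, mul_one,
    neg_zero, neg_neg] at h <;>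
  linarith

/-! ### Step kernels -/

section

variable {n : ℕ}

/-- The partition of `[0,1]` into `n + 1` intervals of equal length. -/
noncomputable def stepIndex (n : ℕ) (x : I) : Fin (n + 1) :=
  ⟨min ⌊((n : ℝ) + 1) * x⌋₊ n, Nat.lt_succ_of_le (min_le_right _ _)⟩

theorem measurable_stepIndex : Measurable (stepIndex n) := by
  have h : Measurable fun k : ℕ =>
      (⟨min k n, Nat.lt_succ_of_le (min_le_right _ _)⟩ : Fin (n + 1)) :=
    measurable_of_countable _
  exact h.comp (Nat.measurable_floor.comp (measurable_subtype_coe.const_mul _))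

/-- The parts have measure at least `1 / (n + 1)`, hence exactly this measure. -/
theorem measureReal_stepIndex (i : Fin (n + 1)) :
    volume.real (stepIndex n ⁻¹' {i}) = 1 / ((n : ℝ) + 1) := by
  have hn : (0 : ℝ) < n + 1 := by positivity
  have hmeas : ∀ i, MeasurableSet (stepIndex n ⁻¹' {i}) := fun i =>
    measurable_stepIndex (measurableSet_singleton i)
  -- The half-open interval suffices: the last part also contains the point `1`.
  have hle : ∀ i ∈ (Finset.univ : Finset (Fin (n + 1))),
      1 / ((n : ℝ) + 1) ≤ volume.real (stepIndex n ⁻¹' {i}) := by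
    intro i _
    have hi : (i : ℝ) + 1 ≤ n + 1 := by exact_mod_cast i.2
    have ha : (i : ℝ) / (n + 1) ∈ I := ⟨by positivity, (div_le_one hn).2 (by linarith)⟩
    have hb : ((i : ℝ) + 1) / (n + 1) ∈ I := ⟨by positivity, (div_le_one hn).2 hi⟩
    have hsub : Set.Ico (⟨_, ha⟩ : I) ⟨_, hb⟩ ⊆ stepIndex n ⁻¹' {i} := by
      rintro x ⟨h1, h2⟩
      have h1 : (i : ℝ) / (n + 1) ≤ x := h1
      have h2 : (x : ℝ) < (i + 1) / (n + 1) := h2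
      rw [div_le_iff₀ hn] at h1
      rw [lt_div_iff₀ hn] at h2
      have hf : ⌊((n : ℝ) + 1) * x⌋₊ = i := by
        rw [Nat.floor_eq_iff (mul_nonneg hn.le x.2.1)]
        constructor <;> linarith
      simp only [Set.mem_preimage, Set.mem_singleton_iff, stepIndex, hf, Fin.ext_iff]
      exact min_eq_left (Nat.le_of_lt_succ i.2)
    calc 1 / ((n : ℝ) + 1) = volume.real (Set.Ico (⟨_, ha⟩ : I) ⟨_, hb⟩) := by
          rw [Measure.real, unitInterval.volume_Ico, ENNReal.toReal_ofReal]
          · simp only; ring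
          · exact sub_nonneg.2 (div_le_div_of_nonneg_right (by linarith) hn.le)
      _ ≤ _ := measureReal_mono hsub
  have hsum : ∑ i : Fin (n + 1), volume.real (stepIndex n ⁻¹' {i}) = 1 := by
    rw [sum_measureReal_preimage_singleton _ fun i _ => hmeas i]
    simp
  refine ((Finset.sum_eq_sum_iff_of_le hle).1 ?_ i (Finset.mem_univ i)).symm
  rw [hsum]
  simp [hn.ne']

theorem integral_stepIndex (f : Fin (n + 1) → ℝ) :
    ∫ x, f (stepIndex n x) = (∑ i, f i) / ((n : ℝ) + 1) := by
  rw [← integral_map (φ := stepIndex n) measurable_stepIndex.aemeasurable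
    (measurable_of_countable f).aestronglyMeasurable,
    integral_fintype (Integrable.of_finite), Finset.sum_div]
  refine Finset.sum_congr rfl fun i _ => ?_
  rw [map_measureReal_apply measurable_stepIndex (measurableSet_singleton i),
    measureReal_stepIndex, smul_eq_mul]
  ring

open Matrix

/-- The step kernel of a skew-symmetric matrix with entries in `{-1, 0, 1}`. -/
noncomputable def stepKernel (A : Matrix (Fin (n + 1)) (Fin (n + 1)) ℤ) (hA : Aᵀ = -A)
    (h1 : ∀ i j, |A i j| ≤ 1) : SkewKernel where
  toFun x y := A (stepIndex n x) (stepIndex n y)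
  measurable_toFun := (measurable_of_countable fun p : Fin (n + 1) × Fin (n + 1) =>
    (A p.1 p.2 : ℝ)).comp ((measurable_stepIndex.comp measurable_fst).prodMk
      (measurable_stepIndex.comp measurable_snd))
  abs_le_one x y := by exact_mod_cast h1 _ _
  skew x y := by exact_mod_cast congrFun (congrFun hA (stepIndex n x)) (stepIndex n y)

variable {A : Matrix (Fin (n + 1)) (Fin (n + 1)) ℤ} (hA : Aᵀ = -A) (h1 : ∀ i j, |A i j| ≤ 1)

theorem walk_stepKernel (k : ℕ) (x : I) : (stepKernel A hA h1).walk k x =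
    (((1 : Fin (n + 1) → ℤ) ᵥ* A ^ k) (stepIndex n x) : ℤ) / ((n : ℝ) + 1) ^ k := by
  induction k generalizing x with
  | zero => simp [SkewKernel.walk]
  | succ k ih =>
    rw [SkewKernel.walk_succ, SkewKernel.op]
    simp only [ih]
    rw [pow_succ A, ← vecMul_vecMul]
    have := integral_stepIndex fun i =>
      (((1 : Fin (n + 1) → ℤ) ᵥ* A ^ k) i : ℤ) / ((n : ℝ) + 1) ^ k * (A i (stepIndex n x) : ℝ)
    refine Eq.trans this ?_
    rw [vecMul, dotProduct, pow_succ, Int.cast_sum, ← div_div]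
    congr 1
    rw [Finset.sum_div]
    refine Finset.sum_congr rfl fun i _ => ?_
    push_cast
    ring

theorem normSq_stepKernel (k : ℕ) : (stepKernel A hA h1).normSq k =
    ((∑ i : Fin (n + 1), ((1 : Fin (n + 1) → ℤ) ᵥ* A ^ k) i ^ 2 : ℤ) : ℝ) /
      ((n : ℝ) + 1) ^ (2 * k + 1) := by
  rw [SkewKernel.normSq]
  simp only [walk_stepKernel]
  have := integral_stepIndex fun i : Fin (n + 1) =>
    ((((1 : Fin (n + 1) → ℤ) ᵥ* A ^ k) i : ℤ) / ((n : ℝ) + 1) ^ k) ^ 2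
  refine this.trans ?_
  rw [pow_succ _ (2 * k), ← div_div, Int.cast_sum]
  congr 1
  rw [Finset.sum_div]
  refine Finset.sum_congr rfl fun i _ => ?_
  push_cast
  rw [div_pow, ← pow_mul, mul_comm k]

theorem power_stepKernel (k : ℕ) (z x : I) : (stepKernel A hA h1).power k z x =
    ((A ^ (k + 1)) (stepIndex n z) (stepIndex n x) : ℤ) / ((n : ℝ) + 1) ^ k := by
  induction k generalizing x with
  | zero => simp [SkewKernel.power, stepKernel]
  | succ k ih =>
    rw [SkewKernel.power_succ, SkewKernel.op]
    simp only [ih]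
    have := integral_stepIndex fun i =>
      ((A ^ (k + 1)) (stepIndex n z) i : ℤ) / ((n : ℝ) + 1) ^ k * (A i (stepIndex n x) : ℝ)
    refine this.trans ?_
    rw [pow_succ A (k + 1), mul_apply, pow_succ ((n : ℝ) + 1), Int.cast_sum, ← div_div]
    congr 1
    rw [Finset.sum_div]
    refine Finset.sum_congr rfl fun i _ => ?_
    push_cast
    ring

theorem hsNormSq_stepKernel (k : ℕ) : (stepKernel A hA h1).hsNormSq k =
    ((∑ i : Fin (n + 1), ∑ j : Fin (n + 1), (A ^ (k + 1)) i j ^ 2 : ℤ) : ℝ) /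
      ((n : ℝ) + 1) ^ (2 * (k + 1)) := by
  rw [SkewKernel.hsNormSq]
  simp only [power_stepKernel]
  have h2 : ∀ z, ∫ x, (((A ^ (k + 1)) (stepIndex n z) (stepIndex n x) : ℤ) /
      ((n : ℝ) + 1) ^ k) ^ 2 = (∑ j, (((A ^ (k + 1)) (stepIndex n z) j : ℤ) /
      ((n : ℝ) + 1) ^ k) ^ 2) / ((n : ℝ) + 1) := fun z =>
    integral_stepIndex fun j => (((A ^ (k + 1)) (stepIndex n z) j : ℤ) / ((n : ℝ) + 1) ^ k) ^ 2
  simp only [h2]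
  refine (integral_stepIndex fun i => (∑ j, (((A ^ (k + 1)) i j : ℤ) /
      ((n : ℝ) + 1) ^ k) ^ 2) / ((n : ℝ) + 1)).trans ?_
  rw [← Finset.sum_div, div_div, ← pow_two, mul_add, mul_one, pow_add _ (2 * k), ← div_div]
  congr 1
  push_cast
  rw [Finset.sum_div]
  refine Finset.sum_congr rfl fun i _ => ?_
  rw [Finset.sum_div]
  refine Finset.sum_congr rfl fun j _ => ?_
  rw [div_pow, ← pow_mul, mul_comm k]

end

/-! ### Non-forcing orientations -/

namespace SkewKernel

/-- The point at `t` of the segment from the kernel `A` to the kernel `B`. -/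
noncomputable def segment (A B : SkewKernel) (t : I) : SkewKernel where
  toFun x y := (1 - t) * A x y + t * B x y
  measurable_toFun := (A.measurable_toFun.const_mul (1 - (t : ℝ))).add
    (B.measurable_toFun.const_mul (t : ℝ))
  abs_le_one x y := by
    have h1 := abs_le.1 (A.abs_le_one x y)
    have h2 := abs_le.1 (B.abs_le_one x y)
    have h3 := t.2.1
    have h4 := t.2.2
    rw [abs_le]
    constructor <;> nlinarith
  skew x y := by rw [A.skew x y, B.skew x y]; ring

theorem segment_zero (A B : SkewKernel) : segment A B 0 = A :=
  SkewKernel.ext fun x y => by simp [segment]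

theorem segment_one (A B : SkewKernel) : segment A B 1 = B :=
  SkewKernel.ext fun x y => by simp [segment]

theorem abs_edge_le (B : SkewKernel) (s : Bool) (x y : I) : |B.edge s x y| ≤ 2 := by
  have h := abs_le.1 (B.abs_le_one x y)
  rw [edge, abs_le]
  cases s <;> simp [sgn] <;> constructor <;> linarith

theorem continuous_cycleSum_segment (A B : SkewKernel) {n : ℕ} (s : Fin (n + 2) → Bool) :
    Continuous fun t => (segment A B t).cycleSum (List.ofFn s) := by
  simp only [cycleSum, ← integral_cycle]
  refine continuous_of_dominated (bound := fun _ => 2 ^ (n + 2)) (fun t => ?_)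
    (fun t => .of_forall fun x => ?_) (integrable_const _) (.of_forall fun x => ?_)
  · exact (BddMeas.prod _ fun i => (segment A B t).bddMeas_edge (by fun_prop)
      (by fun_prop) _).1.aestronglyMeasurable
  · rw [Real.norm_eq_abs, Finset.abs_prod]
    refine (Finset.prod_le_prod (fun i _ => abs_nonneg _) fun i _ => abs_edge_le _ _ _ _).trans ?_
    simp
  · simp only [edge, segment]
    fun_prop

theorem normSq_segment_one (A B : SkewKernel) (hA : ∀ x, A.walk 1 x = 0) (t : I) :
    (segment A B t).normSq 1 = (t : ℝ) ^ 2 * B.normSq 1 := by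
  have h : ∀ x, (segment A B t).walk 1 x = t * B.walk 1 x := fun x => by
    have h0 := hA x
    simp only [walk_succ, walk_zero, op, one_mul] at h0 ⊢
    simp only [segment]
    rw [integral_add ((A.bddMeas_col x).const_mul _).integrable
      ((B.bddMeas_col x).const_mul _).integrable, integral_const_mul, integral_const_mul, h0]
    ring
  simp only [normSq, h, mul_pow, integral_const_mul]

/-- If two kernels, one of them regular and the other one not, give relative densities on
different sides of one, then a kernel on the segment between them has relative density one. -/
theorem not_isQuasirandomForcing (A B : SkewKernel) (hA : ∀ x, A.walk 1 x = 0)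
    (hB : B.normSq 1 ≠ 0) {n : ℕ} (s : Fin (n + 3) → Bool)
    (h : (A.cycleSum (List.ofFn s) - 1) * (B.cycleSum (List.ofFn s) - 1) < 0) :
    ¬ IsQuasirandomForcing (cycleOfSigns s) := by
  rw [isQuasirandomForcing_cycleOfSigns_iff]
  intro hf
  have hc := continuous_cycleSum_segment A B s
  obtain ⟨t, ht⟩ : ∃ t, (segment A B t).cycleSum (List.ofFn s) = 1 := by
    rcases mul_neg_iff.1 h with ⟨h1, h2⟩ | ⟨h1, h2⟩
    · refine mem_range_of_exists_le_of_exists_ge hc ⟨1, ?_⟩ ⟨0, ?_⟩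
      · rw [segment_one]; linarith
      · rw [segment_zero]; linarith
    · refine mem_range_of_exists_le_of_exists_ge hc ⟨0, ?_⟩ ⟨1, ?_⟩
      · rw [segment_zero]; linarith
      · rw [segment_one]; linarith
  have h0 := normSq_one_eq_zero _ (hf _ ht)
  rw [normSq_segment_one A B hA] at h0
  have ht0 : t = 0 := by
    simpa [hB] using h0
  rw [ht0, segment_zero] at ht
  rw [ht] at h
  simp at h

end SkewKernel

/-! ### Evaluation of the density polynomial -/

section

variable {R S : Type*} [CommRing R] [CommRing S]

theorem openSum_congr {m m' : ℕ → R} (l : List Bool) (a p : ℕ)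
    (h : ∀ j ≤ a + p + l.length, m j = m' j) : openSum m l a p = openSum m' l a p := by
  induction l generalizing p with
  | nil => exact h _ (by simp)
  | cons s l ih =>
    rw [List.length_cons] at h
    rw [openSum, openSum, h p (by omega), ih 0 fun j hj => h j (by omega),
      ih (p + 1) fun j hj => h j (by omega)]

theorem closedSum_congr {m m' c : ℕ → R} (l : List Bool) (k : ℕ)
    (h : ∀ j < k + l.length, m j = m' j) : closedSum m c l k = closedSum m' c l k := by
  induction l generalizing k with
  | nil => rfl
  | cons s l ih =>
    rw [List.length_cons] at h
    rw [closedSum, closedSum, openSum_congr l k 0 fun j hj => h j (by omega),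
      ih (k + 1) fun j hj => h j (by omega)]

theorem cyclePoly_congr {b b' : ℕ → R} (t : R) (l : List Bool)
    (h : ∀ j, 2 * j < l.length → b j = b' j) : cyclePoly b t l = cyclePoly b' t l := by
  refine closedSum_congr l 0 fun j hj => ?_
  unfold walkSeq
  split_ifs
  · rw [h (j / 2) (by omega)]
  · rfl

theorem map_openSum (f : R →+* S) (m : ℕ → R) (l : List Bool) (a p : ℕ) :
    f (openSum m l a p) = openSum (fun k => f (m k)) l a p := by
  induction l generalizing p with
  | nil => rfl
  | cons s l ih => cases s <;> simp [openSum, sgn, ih]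

theorem map_closedSum (f : R →+* S) (m c : ℕ → R) (l : List Bool) (k : ℕ) :
    f (closedSum m c l k) = closedSum (fun k => f (m k)) (fun k => f (c k)) l k := by
  induction l generalizing k with
  | nil => rfl
  | cons s l ih => cases s <;> simp [closedSum, sgn, ih, map_openSum]

theorem map_cyclePoly (f : R →+* S) (b : ℕ → R) (t : R) (l : List Bool) :
    f (cyclePoly b t l) = cyclePoly (fun k => f (b k)) (f t) l := by
  have h : (fun k => f (walkSeq b k)) = walkSeq fun k => f (b k) := by
    funext k
    unfold walkSeq
    split_ifs <;> simp
  simp [cyclePoly, map_closedSum, h]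

end

open Matrix

/-! ### A regular and an irregular step kernel -/

/-- The cyclic triangle, as a skew-symmetric matrix. -/
def triangleMatrix : Matrix (Fin 3) (Fin 3) ℤ := !![0, 1, -1; -1, 0, 1; 1, -1, 0]

/-- The skew-symmetric counterpart of a circulant matrix of order 7, with the row and the column
of index 1 negated. -/
def flippedCirculant (v : Fin 7 → ℤ) : Matrix (Fin 7) (Fin 7) ℤ := of fun i j =>
  (if i = 1 then -1 else 1) * (if j = 1 then -1 else 1) * (if i ≤ j then v (j - i) else -v (j - i))

/-- The transitive tournament with 7 vertices after the reversal of all arcs at its second vertex,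
as a skew-symmetric matrix. -/
def flippedMatrix : Matrix (Fin 7) (Fin 7) ℤ := flippedCirculant ![0, 1, 1, 1, 1, 1, 1]

theorem flippedMatrix_pow_two :
    flippedMatrix ^ 2 = flippedCirculant ![-6, -5, -3, -1, 1, 3, 5] := by
  rw [pow_two]; decide +kernel

theorem flippedMatrix_pow_three :
    flippedMatrix ^ 3 = flippedCirculant ![0, -11, -19, -23, -23, -19, -11] := by
  rw [pow_succ, flippedMatrix_pow_two]; decide +kernel

theorem flippedMatrix_pow_four :
    flippedMatrix ^ 4 = flippedCirculant ![106, 95, 65, 23, -23, -65, -95] := by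
  rw [pow_succ, flippedMatrix_pow_three]; decide +kernel

theorem flippedMatrix_pow_five :
    flippedMatrix ^ 5 = flippedCirculant ![0, 201, 361, 449, 449, 361, 201] := by
  rw [pow_succ, flippedMatrix_pow_four]; decide +kernel

/-- The step kernel of the cyclic triangle. -/
noncomputable def triangleKernel : SkewKernel :=
  stepKernel triangleMatrix (by decide +kernel) (by decide +kernel)

/-- The step kernel of `flippedMatrix`. -/
noncomputable def flippedKernel : SkewKernel :=
  stepKernel flippedMatrix (by decide +kernel) (by decide +kernel)

/-- The squared norms `‖B^k 1‖²` for `flippedKernel`. -/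
def flippedNormSq (k : ℕ) : ℚ :=
  [1, 72 / 7 ^ 3, 1368 / 7 ^ 5, 26248 / 7 ^ 7, 503832 / 7 ^ 9].getD k 0

/-- The squared Hilbert–Schmidt norms of `B^(k+1)` for `flippedKernel`. -/
def flippedHsNormSq (k : ℕ) : ℚ :=
  [42 / 7 ^ 2, 742 / 7 ^ 4, 14154 / 7 ^ 6, 271558 / 7 ^ 8, 5212522 / 7 ^ 10].getD k 0

/-- The squared norms `‖B^k 1‖²` for `triangleKernel`. -/
def triangleNormSq (k : ℕ) : ℚ := if k = 0 then 1 else 0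

/-- The squared Hilbert–Schmidt norms of `B^(k+1)` for `triangleKernel`. -/
def triangleHsNormSq (k : ℕ) : ℚ := 2 / 3 ^ (k + 1)

theorem normSq_flippedKernel (k : ℕ) (hk : k < 5) :
    flippedKernel.normSq k = (flippedNormSq k : ℝ) := by
  have h : ∀ c : ℤ, (∑ i : Fin 7, ((1 : Fin 7 → ℤ) ᵥ* flippedMatrix ^ k) i ^ 2) = c →
      flippedKernel.normSq k = (c : ℝ) / 7 ^ (2 * k + 1) := fun c hc => by
    rw [flippedKernel, normSq_stepKernel, hc]
    norm_num
  interval_cases k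
  · rw [h 7 (by decide +kernel)]; norm_num [flippedNormSq]
  · rw [h 72 (by rw [pow_one]; decide +kernel)]; norm_num [flippedNormSq]
  · rw [h 1368 (by rw [flippedMatrix_pow_two]; decide +kernel)]; norm_num [flippedNormSq]
  · rw [h 26248 (by rw [flippedMatrix_pow_three]; decide +kernel)]; norm_num [flippedNormSq]
  · rw [h 503832 (by rw [flippedMatrix_pow_four]; decide +kernel)]; norm_num [flippedNormSq]

theorem hsNormSq_flippedKernel (k : ℕ) (hk : k < 5) :
    flippedKernel.hsNormSq k = (flippedHsNormSq k : ℝ) := by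
  have h : ∀ c : ℤ, (∑ i : Fin 7, ∑ j : Fin 7, (flippedMatrix ^ (k + 1)) i j ^ 2) = c →
      flippedKernel.hsNormSq k = (c : ℝ) / 7 ^ (2 * (k + 1)) := fun c hc => by
    rw [flippedKernel, hsNormSq_stepKernel, hc]
    norm_num
  interval_cases k
  · rw [h 42 (by rw [zero_add, pow_one]; decide +kernel)]; norm_num [flippedHsNormSq]
  · rw [h 742 (by rw [flippedMatrix_pow_two]; decide +kernel)]; norm_num [flippedHsNormSq]
  · rw [h 14154 (by rw [flippedMatrix_pow_three]; decide +kernel)]; norm_num [flippedHsNormSq]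
  · rw [h 271558 (by rw [flippedMatrix_pow_four]; decide +kernel)]; norm_num [flippedHsNormSq]
  · rw [h 5212522 (by rw [flippedMatrix_pow_five]; decide +kernel)]; norm_num [flippedHsNormSq]

theorem walk_one_triangleKernel (x : I) : triangleKernel.walk 1 x = 0 := by
  have h : ∀ i, ((1 : Fin 3 → ℤ) ᵥ* triangleMatrix ^ 1) i = 0 := by
    rw [pow_one]; decide +kernel
  rw [triangleKernel, walk_stepKernel, h]
  simp

theorem normSq_triangleKernel (k : ℕ) : triangleKernel.normSq k = (triangleNormSq k : ℝ) := by
  rcases k with _ | k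
  · simp [SkewKernel.normSq_zero, triangleNormSq]
  · have h : triangleKernel.walk (k + 1) = fun _ => 0 := by
      induction k with
      | zero => exact funext walk_one_triangleKernel
      | succ k ih =>
        rw [SkewKernel.walk_succ, ih]
        funext y
        simp [SkewKernel.op]
    simp [SkewKernel.normSq, h, triangleNormSq]

theorem hsNormSq_triangleKernel (k : ℕ) :
    triangleKernel.hsNormSq k = (triangleHsNormSq k : ℝ) := by
  have h : ∀ k, (∑ i : Fin 3, ∑ j : Fin 3, (triangleMatrix ^ (k + 1)) i j ^ 2) =
      2 * 3 ^ (k + 1) := by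
    have h3 : triangleMatrix ^ 3 = -3 • triangleMatrix := by
      rw [pow_succ, pow_two]; decide +kernel
    intro k
    induction k using Nat.twoStepInduction with
    | zero => rw [zero_add, pow_one]; decide +kernel
    | one => rw [pow_two]; decide +kernel
    | more k ih _ =>
      rw [show k + 2 + 1 = k + 3 by ring, pow_add, h3, Matrix.mul_smul, ← pow_succ]
      simp only [Matrix.smul_apply, smul_eq_mul, mul_pow, ← Finset.mul_sum, ih]
      ring
  rw [triangleKernel, hsNormSq_stepKernel, h, triangleHsNormSq]
  push_cast
  rw [pow_mul, show ((2 : ℝ) + 1) ^ 2 = 3 * 3 by norm_num, mul_pow]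
  field_simp

/-- The two kernels give every listed non-forcing orientation relative densities on different
sides of one. -/
theorem cyclePoly_sub_one_mul_neg {ℓ : ℕ} (hℓ : ℓ ∈ ({4, 6, 8, 10} : Finset ℕ)) :
    ∀ a ∈ nonForcingTypes ℓ,
    (cyclePoly triangleNormSq (triangleHsNormSq (ℓ / 2 - 1)) (blockSigns true a) - 1) *
      (cyclePoly flippedNormSq (flippedHsNormSq (ℓ / 2 - 1)) (blockSigns true a) - 1) < 0 := by
  simp only [Finset.mem_insert, Finset.mem_singleton] at hℓ
  rcases hℓ with rfl | rfl | rfl | rfl <;> decide +kernel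

/-! ### Invariance under similarity -/

theorem mem_arcs {V : Type*} [Fintype V] {H : Digraph V} {e : V × V} :
    e ∈ arcs H ↔ H.Adj e.1 e.2 := by
  simp [arcs]

section

variable {V W : Type*} [Fintype V] [Fintype W] {H : Digraph V} {K : Digraph W}

theorem prod_arcs_of_relIso (e : H.Adj ≃r K.Adj) (F : W → W → ℝ) :
    ∏ a ∈ arcs H, F (e a.1) (e a.2) = ∏ a ∈ arcs K, F a.1 a.2 :=
  Finset.prod_equiv (e.toEquiv.prodCongr e.toEquiv)
    (fun a => by simpa [mem_arcs] using e.map_rel_iff.symm) fun _ _ => rfl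

theorem card_arcs_of_relIso (e : H.Adj ≃r K.Adj) : (arcs H).card = (arcs K).card :=
  Finset.card_equiv (e.toEquiv.prodCongr e.toEquiv)
    fun a => by simpa [mem_arcs] using e.map_rel_iff.symm

theorem homDensity_of_relIso (e : H.Adj ≃r K.Adj) (U : I → I → ℝ) :
    homDensity H U = homDensity K U := by
  rw [homDensity, homDensity,
    ← (volume_measurePreserving_piCongrLeft (fun _ : V => I) e.toEquiv.symm).integral_comp']
  refine integral_congr_ae (.of_forall fun y => ?_)
  simp only
  rw [← prod_arcs_of_relIso e fun v w => U (y v) (y w)]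
  have h : ∀ v, MeasurableEquiv.piCongrLeft (fun _ : V => I) e.toEquiv.symm y v = y (e v) :=
    fun v => by
      have := MeasurableEquiv.piCongrLeft_apply_apply (β := fun _ : V => I) e.toEquiv.symm y (e v)
      rwa [show e.toEquiv.symm (e v) = v from e.toEquiv.symm_apply_apply v] at this
  simp only [h]

theorem IsQuasirandomForcing.of_relIso (hK : IsQuasirandomForcing K) (e : H.Adj ≃r K.Adj) :
    IsQuasirandomForcing H := fun U hU =>
  hK U (by rw [← homDensity_of_relIso e, hU, card_arcs_of_relIso e])

/-- The converse of a directed graph: all arcs are reversed. -/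
def converse (H : Digraph V) : Digraph V := ⟨fun v w => H.Adj w v⟩

/-- The tournamenton `W(y, x)`. -/
def Tournamenton.swap (U : Tournamenton) : Tournamenton where
  toFun x y := U.toFun y x
  measurable_toFun := U.measurable_toFun.comp measurable_swap
  nonneg x y := U.nonneg y x
  add_swap x y := U.add_swap y x

theorem arcs_converse (H : Digraph V) :
    arcs (converse H) = (arcs H).map (Equiv.prodComm V V).toEmbedding := by
  ext ⟨v, w⟩
  simp only [mem_arcs, converse, Finset.mem_map_equiv]
  rfl

theorem IsQuasirandomForcing.converse (hH : IsQuasirandomForcing H) :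
    IsQuasirandomForcing (converse H) := fun U hU => by
  have h : homDensity H U.swap.toFun = (1 / 2 : ℝ) ^ (arcs H).card := by
    rw [arcs_converse, Finset.card_map] at hU
    rw [← hU, homDensity, homDensity, arcs_converse]
    simp only [Finset.prod_map]
    rfl
  filter_upwards [hH U.swap h] with p hp
  have := U.add_swap p.1 p.2
  simp only [Tournamenton.swap] at hp
  linarith

theorem IsQuasirandomForcing.of_similar (hK : IsQuasirandomForcing K) (h : Similar H K) :
    IsQuasirandomForcing H := by
  rcases h with ⟨⟨e⟩⟩ | ⟨⟨e⟩⟩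
  · exact hK.of_relIso e
  · exact IsQuasirandomForcing.of_relIso (K := QuasirandomCycles.converse K) hK.converse e

end

/-! ### Orientations of cycles and sign sequences -/

section

variable {n : ℕ}

theorem cycleOfSigns_adj_add_one (s : Fin (n + 3) → Bool) (v : Fin (n + 3)) :
    (cycleOfSigns s).Adj v (v + 1) ↔ s v = true := by
  rw [cycleOfSigns_adj]
  simp [fin_ne_add_one_add_one]

theorem cycleOfSigns_add_one_adj (s : Fin (n + 3) → Bool) (v : Fin (n + 3)) :
    (cycleOfSigns s).Adj (v + 1) v ↔ s v = false := by
  rw [cycleOfSigns_adj]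
  simp [fin_ne_add_one_add_one]

theorem isOrientation_cycleOfSigns (s : Fin (n + 3) → Bool) :
    IsOrientation (SimpleGraph.cycleGraph (n + 3)) (cycleOfSigns s) := by
  constructor
  · intro v w h
    rcases (cycleOfSigns_adj s v w).1 h with ⟨rfl, hs⟩ | ⟨rfl, hs⟩
    · simp [cycleOfSigns_add_one_adj, hs]
    · simp [cycleOfSigns_adj_add_one, hs]
  · intro v w
    rw [SimpleGraph.cycleGraph_adj, cycleOfSigns_adj, cycleOfSigns_adj, sub_eq_iff_eq_add,
      sub_eq_iff_eq_add, add_comm 1, add_comm 1]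
    cases s v <;> cases s w <;> simp <;> tauto

theorem exists_eq_cycleOfSigns (C : CycleOrientation (n + 3)) : ∃ s, C.1 = cycleOfSigns s := by
  classical
  obtain ⟨H, hasymm, hadj⟩ := C
  refine ⟨fun i => decide (H.Adj i (i + 1)), ?_⟩
  have h : ∀ v w, H.Adj v w → w = v + 1 ∨ v = w + 1 := fun v w hvw => by
    have := (hadj v w).2 (.inl hvw)
    rw [SimpleGraph.cycleGraph_adj, sub_eq_iff_eq_add, sub_eq_iff_eq_add, add_comm 1,
      add_comm 1] at this
    exact this.symm
  ext v w
  rw [cycleOfSigns_adj]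
  simp only [decide_eq_true_eq, decide_eq_false_iff_not]
  constructor
  · intro hvw
    rcases h v w hvw with rfl | rfl
    · exact .inl ⟨rfl, hvw⟩
    · exact .inr ⟨rfl, hasymm _ _ hvw⟩
  · rintro (⟨rfl, hvw⟩ | ⟨rfl, hvw⟩)
    · exact hvw
    · refine ((hadj w (w + 1)).1 ?_).resolve_left hvw
      rw [SimpleGraph.cycleGraph_adj]
      simp

/-- An adjacency-preserving permutation of a cycle is a rotation or a reflection. -/
theorem exists_rotation_or_reflection (e : Fin (n + 3) ≃ Fin (n + 3))
    (he : ∀ v, e (v + 1) = e v + 1 ∨ e v = e (v + 1) + 1) :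
    ∃ k, (∀ v, e v = v + k) ∨ ∀ v, e v = k - v := by
  -- Two consecutive steps cannot go in opposite directions, as `e` is injective.
  have step : ∀ v, e (v + 1 + 1) = e (v + 1) + 1 ↔ e (v + 1) = e v + 1 := fun v => by
    have hne : e (v + 1 + 1) ≠ e v := fun h => fin_ne_add_one_add_one v (e.injective h).symm
    constructor
    · exact fun h => (he v).resolve_right fun h' => hne (h.trans h'.symm)
    · intro h
      refine (he (v + 1)).resolve_right fun h' => hne ?_
      exact add_right_cancel (h'.symm.trans h)
  have all : ∀ v, e (v + 1) = e v + 1 ↔ e (0 + 1) = e 0 + 1 := fun v => by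
    induction v using Fin.induction with
    | zero => rfl
    | succ i ih => rw [← ih, ← Fin.coeSucc_eq_succ]; exact step _
  refine ⟨e 0, ?_⟩
  by_cases h0 : e (0 + 1) = e 0 + 1
  · left
    intro v
    induction v using Fin.induction with
    | zero => simp
    | succ i ih => rw [← Fin.coeSucc_eq_succ, (all _).2 h0, ih]; abel
  · right
    intro v
    induction v using Fin.induction with
    | zero => simp
    | succ i ih =>
      rw [← Fin.coeSucc_eq_succ, ← sub_sub, ← ih,
        (he i.castSucc).resolve_left (mt (all _).1 h0)]
      abel

theorem exists_of_relIso_cycleOfSigns {s t : Fin (n + 3) → Bool}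
    (e : (cycleOfSigns s).Adj ≃r (cycleOfSigns t).Adj) :
    ∃ k, (∀ v, s v = t (v + k)) ∨ ∀ v, s v = !t (k - v) := by
  obtain ⟨k, hk | hk⟩ := exists_rotation_or_reflection e.toEquiv fun v => by
    have h : (cycleOfSigns s).Adj v (v + 1) ∨ (cycleOfSigns s).Adj (v + 1) v := by
      rw [cycleOfSigns_adj_add_one, cycleOfSigns_add_one_adj]
      cases s v <;> simp
    rw [← e.map_rel_iff, ← e.map_rel_iff (a := v + 1), cycleOfSigns_adj, cycleOfSigns_adj] at h
    change e (v + 1) = e v + 1 ∨ e v = e (v + 1) + 1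
    tauto
  · refine ⟨k, .inl fun v => ?_⟩
    have hk : ∀ v, e v = v + k := hk
    rw [Bool.eq_iff_iff, ← cycleOfSigns_adj_add_one, ← e.map_rel_iff, hk, hk,
      show v + 1 + k = v + k + 1 by abel, cycleOfSigns_adj_add_one]
  · refine ⟨k - 1, .inr fun v => ?_⟩
    have hk : ∀ v, e v = k - v := hk
    rw [Bool.eq_iff_iff, ← cycleOfSigns_adj_add_one, ← e.map_rel_iff, hk, hk,
      show k - v = k - 1 - v + 1 by abel, show k - (v + 1) = k - 1 - v by abel,
      cycleOfSigns_add_one_adj]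
    simp

theorem converse_cycleOfSigns (s : Fin (n + 3) → Bool) :
    converse (cycleOfSigns s) = cycleOfSigns fun v => !s v := by
  ext v w
  simp only [converse, cycleOfSigns_adj]
  simp
  tauto

/-- Two sign sequences give similar oriented cycles if and only if they differ by a rotation or a
reflection, possibly after a global change of signs. -/
theorem similar_cycleOfSigns_iff (s t : Fin (n + 3) → Bool) :
    Similar (cycleOfSigns s) (cycleOfSigns t) ↔ ∃ k b,
      (∀ v, s v = (b ^^ t (v + k))) ∨ ∀ v, s v = (b ^^ t (k - v)) := by
  have conv : ∀ t : Fin (n + 3) → Bool,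
      (fun v w => (cycleOfSigns t).Adj w v) = (cycleOfSigns fun v => !t v).Adj := fun t => by
    rw [← converse_cycleOfSigns]
    rfl
  constructor
  · rintro (⟨⟨e⟩⟩ | ⟨⟨e⟩⟩)
    · obtain ⟨k, h | h⟩ := exists_of_relIso_cycleOfSigns e
      · exact ⟨k, false, .inl fun v => by simp [h]⟩
      · exact ⟨k, true, .inr fun v => by simp [h]⟩
    · rw [conv] at e
      obtain ⟨k, h | h⟩ := exists_of_relIso_cycleOfSigns e
      · exact ⟨k, true, .inl fun v => by simp [h]⟩
      · exact ⟨k, false, .inr fun v => by simp [h]⟩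
  · have rot : ∀ (t : Fin (n + 3) → Bool) k, (∀ v, s v = t (v + k)) →
        Nonempty ((cycleOfSigns s).Adj ≃r (cycleOfSigns t).Adj) := fun t k h =>
      ⟨⟨Equiv.addRight k, fun {v w} => by
        simp only [cycleOfSigns_adj, h, Equiv.coe_addRight, add_right_comm _ k 1, add_left_inj]⟩⟩
    have refl : ∀ (t : Fin (n + 3) → Bool) k, (∀ v, s v = !t (k - v)) →
        Nonempty ((cycleOfSigns s).Adj ≃r (cycleOfSigns t).Adj) := fun t k h =>
      ⟨⟨Equiv.subLeft (k + 1), fun {v w} => by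
        have e1 : ∀ v w : Fin (n + 3), k + 1 - w = k + 1 - v + 1 ↔ v = w + 1 := fun v w => by
          rw [sub_eq_iff_eq_add, show k + 1 - v + 1 + w = k + 1 + (w + 1 - v) by abel,
            left_eq_add, sub_eq_zero, eq_comm]
        simp only [cycleOfSigns_adj, h, Equiv.subLeft_apply, e1]
        constructor
        · rintro (⟨rfl, h⟩ | ⟨rfl, h⟩)
          · right
            simpa [show k + 1 - (w + 1) = k - w by abel] using h
          · left
            simpa [show k + 1 - (v + 1) = k - v by abel] using h
        · rintro (⟨rfl, h⟩ | ⟨rfl, h⟩)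
          · right
            simpa [show k + 1 - (v + 1) = k - v by abel] using h
          · left
            simpa [show k + 1 - (w + 1) = k - w by abel] using h⟩⟩
    rintro ⟨k, b, h | h⟩ <;> cases b
    · exact .inl (rot t k (by simpa using h))
    · exact .inr (by rw [conv]; exact rot _ k (by simpa using h))
    · exact .inr (by rw [conv]; exact refl _ k (by simpa using h))
    · exact .inl (refl t k (by simpa using h))

end

/-! ### Sign sequences as lists -/

/-- The first `k` rotations of a sign sequence. -/
def rotations : ℕ → List Bool → List (List Bool)
  | 0, _ => []
  | _, [] => []
  | k + 1, b :: l => (b :: l) :: rotations k (l ++ [b])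

theorem mem_rotations {k : ℕ} {l x : List Bool} (hl : l ≠ []) :
    x ∈ rotations k l ↔ ∃ j < k, x = l.rotate j := by
  induction k generalizing l with
  | zero => simp [rotations]
  | succ k ih =>
    obtain ⟨b, l, rfl⟩ := List.exists_cons_of_ne_nil hl
    rw [rotations, List.mem_cons, ih (by simp)]
    constructor
    · rintro (rfl | ⟨j, hj, rfl⟩)
      · exact ⟨0, by omega, by simp⟩
      · exact ⟨j + 1, by omega, by simp [List.rotate_cons_succ]⟩
    · rintro ⟨_ | j, hj, rfl⟩
      · simp
      · exact .inr ⟨j, by omega, by simp [List.rotate_cons_succ]⟩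

/-- The images of a sign sequence under rotations, reflections and global changes of signs. -/
def orbit (l : List Bool) : List (List Bool) :=
  rotations l.length l ++ rotations l.length l.reverse ++ rotations l.length (l.map not) ++
    rotations l.length (l.map not).reverse

theorem mem_orbit {l x : List Bool} (hl : l ≠ []) : x ∈ orbit l ↔ ∃ k < l.length,
    x = l.rotate k ∨ x = l.reverse.rotate k ∨ x = (l.map not).rotate k ∨
      x = (l.map not).reverse.rotate k := by
  simp only [orbit, List.mem_append]
  rw [mem_rotations hl, mem_rotations (by simpa using hl), mem_rotations (by simpa using hl),
    mem_rotations (by simpa using hl)]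
  grind

/-- The sign sequences of length `n`. -/
def allSigns : ℕ → List (List Bool)
  | 0 => [[]]
  | n + 1 => (allSigns n).map (List.cons true) ++ (allSigns n).map (List.cons false)

theorem mem_allSigns {n : ℕ} {l : List Bool} : l ∈ allSigns n ↔ l.length = n := by
  induction n generalizing l with
  | zero => simp [allSigns]
  | succ n ih =>
    rcases l with _ | ⟨b, l⟩
    · simp [allSigns]
    · cases b <;> simp [allSigns, ih]

theorem nodup_allSigns (n : ℕ) : (allSigns n).Nodup := by
  induction n with
  | zero => simp [allSigns]
  | succ n ih =>
    refine List.Nodup.append (ih.map List.cons_injective) (ih.map List.cons_injective) ?_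
    simp [List.disjoint_left]

/-- The number with a given list of binary digits, the least significant digit first. -/
def code (l : List Bool) : ℕ := l.foldr (fun b m => 2 * m + b.toNat) 0

theorem code_injective_of_length {l l' : List Bool} (h : l.length = l'.length)
    (hc : code l = code l') : l = l' := by
  induction l generalizing l' with
  | nil => exact (List.length_eq_zero_iff.1 h.symm).symm
  | cons b l ih =>
    rcases l' with _ | ⟨b', l'⟩
    · simp at h
    · simp only [code, List.foldr_cons] at hc ih
      have hb : b = b' := by
        cases b <;> cases b' <;> simp at hc ⊢ <;> omega
      subst hb
      rw [ih (by simpa using h) (by omega)]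

theorem code_lt (l : List Bool) : code l < 2 ^ l.length := by
  induction l with
  | nil => simp [code]
  | cons b l ih =>
    simp only [code, List.foldr_cons, List.length_cons, pow_succ] at ih ⊢
    have := Bool.toNat_le b
    omega

/-- The set of the codes of the sign sequences in the orbit of `l`, encoded by the binary digits of
a single number, on which set operations are fast to evaluate. -/
def orbitMask (l : List Bool) : ℕ := (orbit l).foldr (fun x m => 2 ^ code x ||| m) 0

theorem testBit_orbitMask (l : List Bool) (j : ℕ) :
    (orbitMask l).testBit j = true ↔ ∃ x ∈ orbit l, code x = j := by
  unfold orbitMask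
  induction orbit l with
  | nil => simp
  | cons x L ih => simp [Nat.testBit_or, ih, Nat.testBit_two_pow]

/-- The union of the orbits of the given orientations, encoded as in `orbitMask`. -/
def typesMask (T : List (List ℕ)) : ℕ :=
  T.foldr (fun a m => orbitMask (blockSigns true a) ||| m) 0

theorem testBit_typesMask (T : List (List ℕ)) (j : ℕ) : (typesMask T).testBit j = true ↔
    ∃ a ∈ T, (orbitMask (blockSigns true a)).testBit j = true := by
  unfold typesMask
  induction T with
  | nil => simp
  | cons a T ih => simp [Nat.testBit_or, ih]

theorem length_of_mem_orbit {l x : List Bool} (hl : l ≠ []) (h : x ∈ orbit l) :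
    x.length = l.length := by
  obtain ⟨k, -, rfl | rfl | rfl | rfl⟩ := (mem_orbit hl).1 h <;> simp

section

variable {n : ℕ}

theorem ofFn_eq_rotate_iff (s t : Fin (n + 1) → Bool) (k : Fin (n + 1)) :
    List.ofFn s = (List.ofFn t).rotate k ↔ ∀ v, s v = t (v + k) := by
  rw [List.ext_get_iff]
  simp only [List.length_ofFn, List.length_rotate, List.get_eq_getElem, List.getElem_ofFn,
    List.getElem_rotate, true_and]
  constructor
  · intro h v
    exact h v (v.2) (v.2)
  · intro h i hi _
    exact h ⟨i, hi⟩

theorem ofFn_eq_reverse_iff (s t : Fin (n + 1) → Bool) :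
    List.ofFn s = (List.ofFn t).reverse ↔ ∀ v, s v = t (-1 - v) := by
  rw [List.ext_get_iff]
  simp only [List.length_ofFn, List.length_reverse, List.get_eq_getElem, List.getElem_ofFn,
    List.getElem_reverse, true_and]
  have hr : ∀ v : Fin (n + 1), (⟨n + 1 - 1 - v, by omega⟩ : Fin (n + 1)) = -1 - v := fun v => by
    rw [eq_sub_iff_add_eq, eq_neg_iff_add_eq_zero, Fin.ext_iff, Fin.val_add, Fin.val_add,
      Fin.val_one', Fin.val_zero, Nat.mod_add_mod, Nat.add_mod_mod]
    have := v.2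
    rw [show n + 1 - 1 - (v : ℕ) + v + 1 = n + 1 by omega, Nat.mod_self]
  constructor
  · intro h v
    rw [← hr]
    exact h v (v.2) (v.2)
  · intro h i hi _
    have := h ⟨i, hi⟩
    rwa [← hr] at this

theorem ofFn_mem_orbit_iff (s t : Fin (n + 3) → Bool) :
    List.ofFn s ∈ orbit (List.ofFn t) ↔ Similar (cycleOfSigns s) (cycleOfSigns t) := by
  have hrot : ∀ (t : Fin (n + 3) → Bool) (k : Fin (n + 3)),
      (List.ofFn t).rotate k = List.ofFn fun v => t (v + k) := fun t k =>
    ((ofFn_eq_rotate_iff _ t k).2 fun _ => rfl).symm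
  have hrev : ∀ (t : Fin (n + 3) → Bool),
      (List.ofFn t).reverse = List.ofFn fun v => t (-1 - v) := fun t =>
    ((ofFn_eq_reverse_iff _ t).2 fun _ => rfl).symm
  have hne : List.ofFn t ≠ [] := by simp
  rw [similar_cycleOfSigns_iff, mem_orbit hne]
  simp only [List.length_ofFn, List.map_ofFn]
  constructor
  · rintro ⟨k, hk, h⟩
    have hr := fun t => hrot t ⟨k, hk⟩
    simp only at hr
    simp only [hr, hrev, List.ofFn_inj, funext_iff, Function.comp_apply] at h
    have e : ∀ v : Fin (n + 3), -1 - (v + ⟨k, hk⟩) = -1 - ⟨k, hk⟩ - v := fun v => by abel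
    rcases h with h | h | h | h
    · exact ⟨⟨k, hk⟩, false, .inl fun v => by simp [h v]⟩
    · exact ⟨-1 - ⟨k, hk⟩, false, .inr fun v => by simp [h v, e]⟩
    · exact ⟨⟨k, hk⟩, true, .inl fun v => by simp [h v]⟩
    · exact ⟨-1 - ⟨k, hk⟩, true, .inr fun v => by simp [h v, e]⟩
  · rintro ⟨k, b, h | h⟩
    · refine ⟨k, k.2, ?_⟩
      simp only [hrot, hrev, List.ofFn_inj, funext_iff, Function.comp_apply]
      cases b
      · exact .inl fun v => by simp [h v]
      · exact .inr (.inr (.inl fun v => by simp [h v]))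
    · refine ⟨(-1 - k : Fin (n + 3)), (-1 - k).2, ?_⟩
      have e : ∀ v : Fin (n + 3), -1 - (v + (-1 - k)) = k - v := fun v => by abel
      simp only [hrot, hrev, List.ofFn_inj, funext_iff, Function.comp_apply, e]
      cases b
      · exact .inr (.inl fun v => by simp [h v])
      · exact .inr (.inr (.inr fun v => by simp [h v]))

theorem testBit_orbitMask_ofFn (s t : Fin (n + 3) → Bool) :
    (orbitMask (List.ofFn t)).testBit (code (List.ofFn s)) = true ↔
      Similar (cycleOfSigns s) (cycleOfSigns t) := by
  rw [testBit_orbitMask, ← ofFn_mem_orbit_iff]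
  constructor
  · rintro ⟨x, hx, hc⟩
    have := length_of_mem_orbit (by simp) hx
    rwa [← code_injective_of_length (by simpa using this) hc]
  · exact fun h => ⟨_, h, rfl⟩

theorem cycleOfBlocks_eq {a : List ℕ} (ha : (blockSigns true a).length = n + 3) :
    ∃ t : Fin (n + 3) → Bool, cycleOfBlocks (n + 3) a = cycleOfSigns t ∧
      List.ofFn t = blockSigns true a := by
  refine ⟨_, rfl, List.ext_getElem (by simp [ha]) fun i h1 h2 => ?_⟩
  rw [List.getElem_ofFn, List.getD_eq_getElem?_getD, List.getElem?_eq_getElem h2, Option.getD_some]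

end

/-! ### Enumeration of the orientations -/

/-- The listed orientations of the cycle of length `ℓ`. -/
def cycleTypes (ℓ : ℕ) : List (List ℕ) := forcingTypes ℓ ++ nonForcingTypes ℓ

theorem length_blockSigns {ℓ : ℕ} (hℓ : ℓ ∈ ({4, 6, 8, 10} : Finset ℕ)) :
    ∀ a ∈ cycleTypes ℓ, (blockSigns true a).length = ℓ := by
  simp only [Finset.mem_insert, Finset.mem_singleton] at hℓ
  rcases hℓ with rfl | rfl | rfl | rfl <;> decide +kernel

/-- The listed orientations are pairwise not similar. -/
theorem eq_of_testBit_orbitMask {ℓ : ℕ} (hℓ : ℓ ∈ ({4, 6, 8, 10} : Finset ℕ)) :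
    ∀ b ∈ cycleTypes ℓ, ∀ a ∈ cycleTypes ℓ,
      (orbitMask (blockSigns true b)).testBit (code (blockSigns true a)) = true → a = b := by
  simp only [Finset.mem_insert, Finset.mem_singleton] at hℓ
  rcases hℓ with rfl | rfl | rfl | rfl <;> decide +kernel

/-- The orbits of the listed orientations cover all orientations. -/
theorem typesMask_cycleTypes {ℓ : ℕ} (hℓ : ℓ ∈ ({4, 6, 8, 10} : Finset ℕ)) :
    typesMask (cycleTypes ℓ) = 2 ^ 2 ^ ℓ - 1 := by
  simp only [Finset.mem_insert, Finset.mem_singleton] at hℓ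
  rcases hℓ with rfl | rfl | rfl | rfl <;> decide +kernel

theorem countP_forcingTypes :
    (allSigns 4).countP (fun l => (typesMask (forcingTypes 4)).testBit (code l)) = 14 ∧
    (allSigns 6).countP (fun l => (typesMask (forcingTypes 6)).testBit (code l)) = 28 ∧
    (allSigns 8).countP (fun l => (typesMask (forcingTypes 8)).testBit (code l)) = 142 ∧
    (allSigns 10).countP (fun l => (typesMask (forcingTypes 10)).testBit (code l)) = 414 := by
  decide +kernel

theorem nodup_cycleTypes {ℓ : ℕ} (hℓ : ℓ ∈ ({4, 6, 8, 10} : Finset ℕ)) :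
    (cycleTypes ℓ).Nodup := by
  simp only [Finset.mem_insert, Finset.mem_singleton] at hℓ
  rcases hℓ with rfl | rfl | rfl | rfl <;> decide +kernel

/-! ### Classification and counting -/

theorem exists_eq_add_three {ℓ : ℕ} (hℓ : ℓ ∈ ({4, 6, 8, 10} : Finset ℕ)) :
    ∃ n h, ℓ = n + 3 ∧ ℓ = 2 * (h + 1 + 1) ∧ h < 4 := by
  simp only [Finset.mem_insert, Finset.mem_singleton] at hℓ
  exact ⟨ℓ - 3, ℓ / 2 - 2, by omega⟩

theorem isQuasirandomForcing_of_mem_forcingTypes {ℓ : ℕ} (hℓ : ℓ ∈ ({4, 6, 8, 10} : Finset ℕ))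
    {a : List ℕ} (ha : a ∈ forcingTypes ℓ) : IsQuasirandomForcing (cycleOfBlocks ℓ a) := by
  have hlen := length_blockSigns hℓ a (List.mem_append_left _ ha)
  obtain ⟨n, h, rfl, hh, -⟩ := exists_eq_add_three hℓ
  obtain ⟨t, ht, htl⟩ := cycleOfBlocks_eq hlen
  rw [ht, isQuasirandomForcing_cycleOfSigns_iff, htl]
  intro B hB
  rw [B.cycleSum_eq _ (h + 1) (hlen.trans hh)] at hB
  refine B.ae_eq_zero_of_hsNormSq_eq_zero h (by_contra fun h0 => ?_)
  exact B.isNormSeq.cyclePoly_ne_one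
    ((B.hsNormSq_nonneg (h + 1)).lt_of_ne (Ne.symm h0)) hℓ ha hB

theorem cycleSum_eq_cast {B : SkewKernel} {b t : ℕ → ℚ} (hb : ∀ k < 5, B.normSq k = b k)
    (ht : ∀ k < 5, B.hsNormSq k = t k) {l : List Bool} {h : ℕ} (hl : l.length = 2 * (h + 1))
    (hh : h < 5) : B.cycleSum l = ((cyclePoly b (t h) l : ℚ) : ℝ) := by
  rw [B.cycleSum_eq l h hl, ht h hh, cyclePoly_congr (b' := fun k => (b k : ℝ)) _ _
    fun j hj => hb j (by omega)]
  exact (map_cyclePoly (Rat.castHom ℝ) b (t h) l).symm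

theorem not_isQuasirandomForcing_of_mem_nonForcingTypes {ℓ : ℕ}
    (hℓ : ℓ ∈ ({4, 6, 8, 10} : Finset ℕ)) {a : List ℕ} (ha : a ∈ nonForcingTypes ℓ) :
    ¬ IsQuasirandomForcing (cycleOfBlocks ℓ a) := by
  have hlen := length_blockSigns hℓ a (List.mem_append_right _ ha)
  have hneg := cyclePoly_sub_one_mul_neg hℓ a ha
  obtain ⟨n, h, rfl, hh, hh4⟩ := exists_eq_add_three hℓ
  obtain ⟨t, ht, htl⟩ := cycleOfBlocks_eq hlen
  rw [ht]
  refine SkewKernel.not_isQuasirandomForcing triangleKernel flippedKernel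
    walk_one_triangleKernel ?_ t ?_
  · rw [normSq_flippedKernel 1 (by norm_num)]
    norm_num [flippedNormSq]
  · rw [show (n + 3) / 2 - 1 = h + 1 by omega] at hneg
    rw [htl, cycleSum_eq_cast (fun k _ => normSq_triangleKernel k)
      (fun k _ => hsNormSq_triangleKernel k) (hlen.trans hh) (by omega),
      cycleSum_eq_cast normSq_flippedKernel hsNormSq_flippedKernel (hlen.trans hh) (by omega)]
    exact_mod_cast hneg

/-- An orientation lies in the union of some of the listed orbits if and only if it is similar to
one of the corresponding orientations. -/
theorem testBit_typesMask_iff {n : ℕ} {T : List (List ℕ)}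
    (hT : ∀ a ∈ T, (blockSigns true a).length = n + 3) (s : Fin (n + 3) → Bool) :
    (typesMask T).testBit (code (List.ofFn s)) = true ↔
      ∃ a ∈ T, Similar (cycleOfSigns s) (cycleOfBlocks (n + 3) a) := by
  rw [testBit_typesMask]
  refine exists_congr fun a => and_congr_right fun ha => ?_
  obtain ⟨t, ht, htl⟩ := cycleOfBlocks_eq (hT a ha)
  rw [ht, ← htl, testBit_orbitMask_ofFn]

theorem exists_similar {ℓ : ℕ} (hℓ : ℓ ∈ ({4, 6, 8, 10} : Finset ℕ)) (C : CycleOrientation ℓ) :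
    ∃ a ∈ cycleTypes ℓ, Similar C.1 (cycleOfBlocks ℓ a) := by
  have hlen := length_blockSigns hℓ
  have hmask := typesMask_cycleTypes hℓ
  obtain ⟨n, h, rfl, -⟩ := exists_eq_add_three hℓ
  obtain ⟨s, hs⟩ := exists_eq_cycleOfSigns C
  rw [hs, ← testBit_typesMask_iff hlen, hmask, Nat.testBit_two_pow_sub_one]
  simpa using code_lt (List.ofFn s)

theorem isQuasirandomForcing_iff {ℓ : ℕ} (hℓ : ℓ ∈ ({4, 6, 8, 10} : Finset ℕ))
    (C : CycleOrientation ℓ) : IsQuasirandomForcing C.1 ↔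
      ∃ a ∈ forcingTypes ℓ, Similar C.1 (cycleOfBlocks ℓ a) := by
  constructor
  · intro hC
    obtain ⟨a, ha, h⟩ := exists_similar hℓ C
    rcases List.mem_append.1 ha with ha | ha
    · exact ⟨a, ha, h⟩
    · exact absurd (hC.of_similar h.symm) (not_isQuasirandomForcing_of_mem_nonForcingTypes hℓ ha)
  · rintro ⟨a, ha, h⟩
    exact (isQuasirandomForcing_of_mem_forcingTypes hℓ ha).of_similar h

theorem not_isQuasirandomForcing_iff {ℓ : ℕ} (hℓ : ℓ ∈ ({4, 6, 8, 10} : Finset ℕ))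
    (C : CycleOrientation ℓ) : ¬ IsQuasirandomForcing C.1 ↔
      ∃ a ∈ nonForcingTypes ℓ, Similar C.1 (cycleOfBlocks ℓ a) := by
  constructor
  · intro hC
    obtain ⟨a, ha, h⟩ := exists_similar hℓ C
    rcases List.mem_append.1 ha with ha | ha
    · exact absurd ((isQuasirandomForcing_of_mem_forcingTypes hℓ ha).of_similar h) hC
    · exact ⟨a, ha, h⟩
  · rintro ⟨a, ha, h⟩ hC
    exact not_isQuasirandomForcing_of_mem_nonForcingTypes hℓ ha (hC.of_similar h.symm)

/-- The similarity class of the orientation with given block lengths. -/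
def blockClass (n : ℕ) (a : List ℕ) : CycleClass (n + 3) :=
  Quotient.mk _ ⟨cycleOfBlocks (n + 3) a, isOrientation_cycleOfSigns _⟩

theorem mk_eq_blockClass_iff {n : ℕ} (C : CycleOrientation (n + 3)) (a : List ℕ) :
    Quotient.mk (cycleSetoid (n + 3)) C = blockClass n a ↔
      Similar C.1 (cycleOfBlocks (n + 3) a) :=
  Quotient.eq

theorem injOn_blockClass {n : ℕ} (hℓ : n + 3 ∈ ({4, 6, 8, 10} : Finset ℕ)) :
    Set.InjOn (blockClass n) {a | a ∈ cycleTypes (n + 3)} := by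
  intro a ha b hb hab
  have hlen := length_blockSigns hℓ
  refine eq_of_testBit_orbitMask hℓ b hb a ha ?_
  obtain ⟨s, hs, hsl⟩ := cycleOfBlocks_eq (hlen a ha)
  obtain ⟨t, ht, htl⟩ := cycleOfBlocks_eq (hlen b hb)
  rw [← hsl, ← htl, testBit_orbitMask_ofFn, ← hs, ← ht]
  exact (mk_eq_blockClass_iff _ b).1 hab

theorem ncard_image_blockClass {n : ℕ} (hℓ : n + 3 ∈ ({4, 6, 8, 10} : Finset ℕ))
    {T : List (List ℕ)} (hT : T.Sublist (cycleTypes (n + 3))) :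
    (blockClass n '' {a | a ∈ T}).ncard = T.length := by
  have hinj : Set.InjOn (blockClass n) {a | a ∈ T} :=
    (injOn_blockClass hℓ).mono fun a ha => hT.subset ha
  rw [hinj.ncard_image, ← List.toFinset_card_of_nodup ((nodup_cycleTypes hℓ).sublist hT),
    ← Set.ncard_coe_finset]
  congr 1
  ext
  simp

theorem card_cycleClass {ℓ : ℕ} (hℓ : ℓ ∈ ({4, 6, 8, 10} : Finset ℕ)) :
    Nat.card (CycleClass ℓ) = (cycleTypes ℓ).length := by
  obtain ⟨n, h, rfl, -⟩ := exists_eq_add_three hℓ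
  rw [← Set.ncard_univ, ← ncard_image_blockClass hℓ (List.Sublist.refl _)]
  congr 1
  refine (Set.eq_univ_of_forall fun c => ?_).symm
  induction c using Quotient.inductionOn with
  | _ C =>
    obtain ⟨a, ha, h⟩ := exists_similar hℓ C
    exact ⟨a, ha, ((mk_eq_blockClass_iff C a).2 h).symm⟩

theorem ncard_forcingClasses {ℓ : ℕ} (hℓ : ℓ ∈ ({4, 6, 8, 10} : Finset ℕ)) :
    (forcingClasses ℓ).ncard = (forcingTypes ℓ).length := by
  have hf := isQuasirandomForcing_iff hℓ
  obtain ⟨n, h, rfl, -⟩ := exists_eq_add_three hℓ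
  rw [← ncard_image_blockClass hℓ (List.sublist_append_left _ _)]
  congr 1
  ext c
  constructor
  · rintro ⟨C, hC, rfl⟩
    obtain ⟨a, ha, h⟩ := (hf C).1 hC
    exact ⟨a, ha, ((mk_eq_blockClass_iff C a).2 h).symm⟩
  · rintro ⟨a, ha, rfl⟩
    exact ⟨⟨_, isOrientation_cycleOfSigns _⟩,
      isQuasirandomForcing_of_mem_forcingTypes hℓ ha, rfl⟩

theorem measureReal_pi_uniform {n : ℕ} (S : Finset (Fin n → Bool)) :
    (Measure.pi fun _ : Fin n => (PMF.uniformOfFintype Bool).toMeasure).real S =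
      S.card / 2 ^ n := by
  rw [← sum_measureReal_singleton]
  have h : ∀ s : Fin n → Bool,
      (Measure.pi fun _ : Fin n => (PMF.uniformOfFintype Bool).toMeasure).real {s} =
        (1 / 2) ^ n := fun s => by
    simp [Measure.real, Measure.pi_singleton]
  simp [h, div_eq_mul_inv]

theorem forcingProbability_eq {ℓ : ℕ} (hℓ : ℓ ∈ ({4, 6, 8, 10} : Finset ℕ)) :
    forcingProbability ℓ =
      (allSigns ℓ).countP (fun l => (typesMask (forcingTypes ℓ)).testBit (code l)) / 2 ^ ℓ := by
  have hlen := length_blockSigns hℓ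
  have hf := isQuasirandomForcing_iff hℓ
  obtain ⟨n, h, rfl, -⟩ := exists_eq_add_three hℓ
  set p : List Bool → Bool := fun l => (typesMask (forcingTypes (n + 3))).testBit (code l) with hp
  have hset : {s | IsQuasirandomForcing (cycleOfSigns s)} =
      ((Finset.univ.filter fun s : Fin (n + 3) → Bool => p (List.ofFn s) = true :
        Finset (Fin (n + 3) → Bool)) : Set (Fin (n + 3) → Bool)) := by
    ext s
    have := hf ⟨cycleOfSigns s, isOrientation_cycleOfSigns s⟩
    rw [← testBit_typesMask_iff fun a ha => hlen a (List.mem_append_left _ ha)] at this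
    simpa [hp] using this
  have hcard : (Finset.univ.filter fun s : Fin (n + 3) → Bool => p (List.ofFn s) = true).card =
      (allSigns (n + 3)).countP p := by
    rw [List.countP_eq_length_filter,
      ← List.toFinset_card_of_nodup ((nodup_allSigns _).filter _),
      ← Finset.card_image_of_injective _ List.ofFn_injective]
    congr 1
    ext l
    simp only [Finset.mem_image, Finset.mem_filter, Finset.mem_univ, true_and, List.mem_toFinset,
      List.mem_filter, mem_allSigns]
    constructor
    · rintro ⟨s, hs, rfl⟩
      exact ⟨List.length_ofFn, hs⟩
    · rintro ⟨hl, hs⟩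
      have e : List.ofFn (fun i : Fin (n + 3) => l[i]) = l :=
        List.ext_getElem (by simp [hl]) fun i _ _ => by rw [List.getElem_ofFn]; rfl
      exact ⟨_, by rwa [e], e⟩
  rw [forcingProbability, hset, measureReal_pi_uniform, hcard]

end QuasirandomCycles

theorem mainTheorem2 :
    -- the complete classification for the lengths 4, 6, 8 and 10
    (∀ ℓ ∈ ({4, 6, 8, 10} : Finset ℕ), ∀ C : QuasirandomCycles.CycleOrientation ℓ,
      (QuasirandomCycles.IsQuasirandomForcing C.1 ↔
        ∃ a ∈ QuasirandomCycles.forcingTypes ℓ,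
          QuasirandomCycles.Similar C.1 (QuasirandomCycles.cycleOfBlocks ℓ a)) ∧
      (¬ QuasirandomCycles.IsQuasirandomForcing C.1 ↔
        ∃ a ∈ QuasirandomCycles.nonForcingTypes ℓ,
          QuasirandomCycles.Similar C.1 (QuasirandomCycles.cycleOfBlocks ℓ a))) ∧
    -- the numbers of all and of quasirandom-forcing orientations up to similarity
    (Nat.card (QuasirandomCycles.CycleClass 4) = 4 ∧
      (QuasirandomCycles.forcingClasses 4).ncard = 3) ∧
    (Nat.card (QuasirandomCycles.CycleClass 6) = 8 ∧
      (QuasirandomCycles.forcingClasses 6).ncard = 4) ∧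
    (Nat.card (QuasirandomCycles.CycleClass 8) = 18 ∧
      (QuasirandomCycles.forcingClasses 8).ncard = 9) ∧
    (Nat.card (QuasirandomCycles.CycleClass 10) = 44 ∧
      (QuasirandomCycles.forcingClasses 10).ncard = 21) ∧
    -- the probability that a random orientation is quasirandom-forcing
    QuasirandomCycles.forcingProbability 4 = 7 / 8 ∧
    QuasirandomCycles.forcingProbability 6 = 7 / 16 ∧
    QuasirandomCycles.forcingProbability 8 = 71 / 128 ∧
    QuasirandomCycles.forcingProbability 10 = 207 / 512 := by
  have h4 : 4 ∈ ({4, 6, 8, 10} : Finset ℕ) := by decide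
  have h6 : 6 ∈ ({4, 6, 8, 10} : Finset ℕ) := by decide
  have h8 : 8 ∈ ({4, 6, 8, 10} : Finset ℕ) := by decide
  have h10 : 10 ∈ ({4, 6, 8, 10} : Finset ℕ) := by decide
  obtain ⟨c4, c6, c8, c10⟩ := QuasirandomCycles.countP_forcingTypes
  refine ⟨fun ℓ hℓ C => ⟨QuasirandomCycles.isQuasirandomForcing_iff hℓ C,
    QuasirandomCycles.not_isQuasirandomForcing_iff hℓ C⟩,
    ⟨QuasirandomCycles.card_cycleClass h4, QuasirandomCycles.ncard_forcingClasses h4⟩,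
    ⟨QuasirandomCycles.card_cycleClass h6, QuasirandomCycles.ncard_forcingClasses h6⟩,
    ⟨QuasirandomCycles.card_cycleClass h8, QuasirandomCycles.ncard_forcingClasses h8⟩,
    ⟨QuasirandomCycles.card_cycleClass h10, QuasirandomCycles.ncard_forcingClasses h10⟩,
    ?_, ?_, ?_, ?_⟩
  · rw [QuasirandomCycles.forcingProbability_eq h4, c4]; norm_num
  · rw [QuasirandomCycles.forcingProbability_eq h6, c6]; norm_num
  · rw [QuasirandomCycles.forcingProbability_eq h8, c8]; norm_num
  · rw [QuasirandomCycles.forcingProbability_eq h10, c10]; norm_num
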